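/- **Definitions.** A *symmetric multicategory* $Q$ has a category $o(Q)$ of objects; arrows $f\in Q(x_1,\dots,x_n;x)$ with source a finite list of objects and target an object; a unary arrow $\iota(a)\in Q(x;y)$ for each object-morphism $a:x\to y$; composites $f\circ(g_1,\dots,g_n)$; and actions of the symmetric groups on sources; subject to the usual unit, associativity and equivariance laws and $\iota(ab)=\iota(a)\circ\iota(b)$. Its *slice* $Q^+$ has as object-category the category $\mathrm{elt}(Q)$ of arrows of $Q$ (morphisms: a permutation of the source together with object-morphisms between sources and between targets, carrying one arrow to the other). An arrow $(f_1,\dots,f_n)\to f$ of $Q^+$ is a planar tree with nodes labelled bijectively by $f_1,\dots,f_n$ and edges labelled by compatible object-morphisms, together with a bijection between its leaves and the source of $f$, such that composing the labels according to the tree (each edge label $a$ acting as $\iota(a)$) and permuting the source gives $f$; composition in $Q^+$ is substitution of trees for nodes. Let $I$ be the symmetric multicategory with exactly one object, one object-morphism and one arrow (the identities), and put $I^{0+}=I$, $I^{(k+1)+}=(I^{k+})^+$. The *category of Baez–Dolan $k$-opetopes* is $\mathbb C_k=o(I^{k+})$. For a monad $T$ on $\mathbf{Set}/S$ (in Leinster's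 construction, a cartesian one), write $T1$ for $T$ applied to the terminal object $S\xrightarrow{1}S$, and $S'$ for the underlying set of $T1$. A *$T$-operad* is a $(\mathbf{Set}/S,T)$-multicategory whose object of objects is terminal: a graph $T1\leftarrow A\to 1$ in $\mathbf{Set}/S$ with identities $1\to A$ and a composition $TA\times_{T1}A\to A$, satisfying the identity and associativity laws. Graphs form the category $(\mathbf{Set}/S)/T1\cong\mathbf{Set}/S'$. If the forgetful functor from $T$-operads to graphs has a left adjoint, the induced monad $T'$ on $\mathbf{Set}/S'$ is the *free $T$-operad monad*. Let $(\mathbf{Set}/S_0,T_0)=(\mathbf{Set}/1,\mathrm{id})$ and $(\mathbf{Set}/S_{k+1},T_{k+1})=(\mathbf{Set}/S_k',T_k')$, so that $(S_{k+1}\to S_k)=T_k(S_k\xrightarrow{1}S_k)$. The elements of $S_k$ are the *Leinster $k$-opetopes*. **Statement.** For every $k\ge 0$ the forgetful functor from $T_k$-operads to graphs has a left adjoint (so that all the monads $(\mathbf{Set}/S_k,T_k)$ and sets $S_k$ above are defined), and the category $\mathbb C_k$ of Baez–Dolan $k$-opetopes is equivalent to the set $S_k$ of Leinster $k$-opetopes,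 regarded as a discrete category: $$\mathbb C_k\simeq S_k .$$ -/

import Mathlib

open CategoryTheory

/-- A symmetric multicategory with a category of objects.  The source of an arrow is a finite family
`x : ι → Obj` of objects.  Sources that are lists `(x₁, …, xₙ)` are the families indexed by
`Fin n`; indexing by arbitrary finite types only saves choosing an enumeration of the disjoint union
`Σ i, κ i` that indexes the source of a composite, and an arrow whose source is indexed by `ι`
is the same thing as an arrow whose source is a list, by way of the symmetric action of a bijection
`Fin n ≃ ι`.  Every law is the usual one, with the canonical reindexing of its two sides
written out. -/
structure SymMulticat where
  Obj : Type
  [cat : SmallCategory Obj]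
  /-- `Hom x y` is the set of arrows with source the family `x` and target `y`. -/
  Hom : {ι : Type} → (ι → Obj) → Obj → Type
  /-- Arrows have finite arity. -/
  finite_source : ∀ {ι : Type} {x : ι → Obj} {y : Obj}, Hom x y → Finite ι
  /-- The unary arrow `ι(f)` of an object-morphism `f`; `incl (𝟙 x)` is the identity arrow. -/
  incl : ∀ {x y : Obj}, (x ⟶ y) → Hom (fun _ : Unit => x) y
  /-- The composite `f ∘ (g_i)_i`. -/
  comp : ∀ {ι : Type} {κ : ι → Type} {x : ι → Obj} {y : Obj} {w : ∀ i, κ i → Obj},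
    Hom x y → (∀ i, Hom (w i) (x i)) → Hom (fun p : Σ i, κ i => w p.1 p.2) y
  /-- The symmetric action, by a bijection `e` of the indexing sets with `x i = x' (e i)`.  For
  `e = σ⁻¹` this is `f ↦ f σ`. -/
  perm : ∀ {ι κ : Type} (e : ι ≃ κ) {x : ι → Obj} {x' : κ → Obj} {y : Obj},
    Hom x y → (∀ i, x i = x' (e i)) → Hom x' y
  /-- Left unit law. -/
  id_comp : ∀ {ι : Type} {x : ι → Obj} {y : Obj} (f : Hom x y),
    comp (incl (𝟙 y)) (fun _ => f) =
      perm (Equiv.uniqueSigma (fun _ : Unit => ι)).symm f (fun _ => rfl)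
  /-- Right unit law. -/
  comp_id : ∀ {ι : Type} {x : ι → Obj} {y : Obj} (f : Hom x y),
    comp f (fun i => incl (𝟙 (x i))) = perm (Equiv.sigmaPUnit ι).symm f (fun _ => rfl)
  /-- Associativity. -/
  assoc : ∀ {ι : Type} {κ : ι → Type} {ν : ∀ i, κ i → Type} {x : ι → Obj} {y : Obj}
    {w : ∀ i, κ i → Obj} {v : ∀ i j, ν i j → Obj}
    (f : Hom x y) (g : ∀ i, Hom (w i) (x i)) (h : ∀ i j, Hom (v i j) (w i j)),
    comp (comp f g) (fun p => h p.1 p.2) =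
      perm (Equiv.sigmaAssoc ν).symm (comp f (fun i => comp (g i) (h i))) (fun _ => rfl)
  /-- The symmetric action is an action. -/
  perm_refl : ∀ {ι : Type} {x : ι → Obj} {y : Obj} (f : Hom x y),
    perm (Equiv.refl ι) f (fun _ => rfl) = f
  perm_perm : ∀ {ι κ ν : Type} (e : ι ≃ κ) (e' : κ ≃ ν) {x : ι → Obj} {x' : κ → Obj}
    {x'' : ν → Obj} {y : Obj} (f : Hom x y) (h : ∀ i, x i = x' (e i))
    (h' : ∀ j, x' j = x'' (e' j)),
    perm e' (perm e f h) h' = perm (e.trans e') f (fun i => (h i).trans (h' (e i)))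
  /-- `(f σ) ∘ (g_{σ i})_i = (f ∘ (g_i)_i) ρ(σ)`. -/
  comp_perm_left : ∀ {ι ι' : Type} {κ : ι' → Type} (e : ι ≃ ι') {x : ι' → Obj} {y : Obj}
    {w : ∀ i, κ i → Obj} (f : Hom (fun i => x (e i)) y) (g : ∀ i, Hom (w i) (x i)),
    comp (perm e f (fun _ => rfl)) g =
      perm (Equiv.sigmaCongrLeft e) (comp f (fun i => g (e i))) (fun _ => rfl)
  /-- `f ∘ (g_i σ_i)_i = (f ∘ (g_i)_i) σ` for the juxtaposition `σ` of the `σ_i`. -/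
  comp_perm_right : ∀ {ι : Type} {κ κ' : ι → Type} (e : ∀ i, κ i ≃ κ' i) {x : ι → Obj} {y : Obj}
    {w : ∀ i, κ i → Obj} {w' : ∀ i, κ' i → Obj}
    (f : Hom x y) (g : ∀ i, Hom (w i) (x i)) (h : ∀ i j, w i j = w' i (e i j)),
    comp f (fun i => perm (e i) (g i) (h i)) =
      perm (Equiv.sigmaCongrRight e) (comp f g) (fun p => h p.1 p.2)
  /-- `ι(b ∘ a) = ι(b) ∘ ι(a)`. -/
  incl_comp : ∀ {x y z : Obj} (a : x ⟶ y) (b : y ⟶ z),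
    comp (incl b) (fun _ => incl a) =
      perm (Equiv.uniqueSigma (fun _ : Unit => Unit)).symm (incl (a ≫ b)) (fun _ => rfl)

attribute [instance] SymMulticat.cat

namespace SymMulticat

variable (Q : SymMulticat)

/-- `ι(b) ∘ f`. -/
def post {ι : Type} {x : ι → Q.Obj} {y y' : Q.Obj} (b : y ⟶ y') (f : Q.Hom x y) : Q.Hom x y' :=
  Q.perm (Equiv.uniqueSigma (fun _ : Unit => ι)) (Q.comp (Q.incl b) (fun _ => f)) (fun _ => rfl)

/-- The functorial action of morphisms of sources and targets on arrows: a bijection `e` of the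
indexing sets and object-morphisms `a i : x' (e i) ⟶ x i` and `b : y ⟶ y'` send an arrow `f` from
`x` to `y` to the arrow `ι(b) ∘ f ∘ (ι(a i))_i`, reindexed along `e`, from `x'` to `y'`. -/
def act {ι κ : Type} (e : ι ≃ κ) {x : ι → Q.Obj} {x' : κ → Q.Obj} {y y' : Q.Obj}
    (a : ∀ i, x' (e i) ⟶ x i) (b : y ⟶ y') (f : Q.Hom x y) : Q.Hom x' y' :=
  Q.perm ((Equiv.sigmaPUnit ι).trans e) (Q.post b (Q.comp f (fun i => Q.incl (a i))))
    (fun _ => rfl)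

theorem perm_congr {ι κ : Type} {e e' : ι ≃ κ} (h : ∀ i, e i = e' i) {x : ι → Q.Obj}
    {x' : κ → Q.Obj} {y : Q.Obj} (f : Q.Hom x y) (hx : ∀ i, x i = x' (e i)) :
    Q.perm e f hx = Q.perm e' f (fun i => h i ▸ hx i) := by
  obtain rfl := Equiv.ext h; rfl

theorem perm_comp_left {ι ι' : Type} {κ : ι' → Type} (e : ι ≃ ι') {x : ι → Q.Obj}
    {x' : ι' → Q.Obj} {y : Q.Obj} {w : ∀ i, κ i → Q.Obj}
    (f : Q.Hom x y) (h : ∀ i, x i = x' (e i)) (g : ∀ i, Q.Hom (w i) (x' i))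
    (g' : ∀ i, Q.Hom (w (e i)) (x i)) (hg : ∀ i, HEq (g (e i)) (g' i)) :
    Q.comp (Q.perm e f h) g =
      Q.perm (Equiv.sigmaCongrLeft e) (Q.comp f g') (fun _ => rfl) := by
  obtain rfl : x = fun i => x' (e i) := funext h
  obtain rfl : (fun i => g (e i)) = g' := funext fun i => eq_of_heq (hg i)
  exact Q.comp_perm_left e f g

theorem post_perm {ι κ : Type} (e : ι ≃ κ) {x : ι → Q.Obj} {x' : κ → Q.Obj} {y y' : Q.Obj}
    (b : y ⟶ y') (f : Q.Hom x y) (h : ∀ i, x i = x' (e i)) :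
    Q.post b (Q.perm e f h) = Q.perm e (Q.post b f) h := by
  unfold post
  erw [Q.comp_perm_right (fun _ => e) _ (fun _ => f) (fun _ => h), Q.perm_perm, Q.perm_perm]
  rfl

theorem post_id {ι : Type} {x : ι → Q.Obj} {y : Q.Obj} (f : Q.Hom x y) :
    Q.post (𝟙 y) f = f := by
  unfold post
  erw [Q.id_comp, Q.perm_perm]
  exact Q.perm_refl f

theorem comp_post {ι : Type} {κ : ι → Type} {x : ι → Q.Obj} {y y' : Q.Obj}
    {w : ∀ i, κ i → Q.Obj} (b : y ⟶ y') (f : Q.Hom x y) (g : ∀ i, Q.Hom (w i) (x i)) :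
    Q.comp (Q.post b f) g = Q.post b (Q.comp f g) := by
  unfold post
  erw [Q.perm_comp_left _ _ _ g (fun p => g p.2) (fun _ => HEq.rfl),
    Q.assoc (Q.incl b) (fun _ => f) (fun _ i => g i), Q.perm_perm]
  rfl

theorem post_post {ι : Type} {x : ι → Q.Obj} {y y' y'' : Q.Obj} (b : y ⟶ y') (b' : y' ⟶ y'')
    (f : Q.Hom x y) : Q.post b' (Q.post b f) = Q.post (b ≫ b') f := by
  have h := Q.assoc (Q.incl b') (fun _ : Unit => Q.incl b) (fun _ _ => f)
  erw [Q.incl_comp, Q.perm_comp_left _ _ _ _ (fun _ => f) (fun _ => HEq.rfl)] at h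
  unfold post
  erw [Q.comp_perm_right (fun _ : Unit => Equiv.uniqueSigma (fun _ : Unit => ι)) _
    (fun _ => Q.comp (Q.incl b) (fun _ => f)) (fun _ _ => rfl), Q.perm_perm]
  have h2 := congrArg (fun t => Q.perm ((Equiv.sigmaAssoc (fun (_ : Unit) (_ : Unit) => ι)).trans
    ((Equiv.sigmaCongrRight (fun _ : Unit => Equiv.uniqueSigma (fun _ : Unit => ι))).trans
     (Equiv.uniqueSigma (fun _ : Unit => ι)))) (x' := x) t (fun _ => rfl)) h
  erw [Q.perm_perm, Q.perm_perm] at h2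
  exact h2.symm

theorem act_id {ι : Type} {x : ι → Q.Obj} {y : Q.Obj} (f : Q.Hom x y) :
    Q.act (Equiv.refl ι) (fun i => 𝟙 (x i)) (𝟙 y) f = f := by
  have h := Q.post_id (Q.perm ((Equiv.sigmaPUnit ι).trans (Equiv.refl ι)) (x' := x)
    (Q.comp f (fun i => Q.incl (𝟙 (x i)))) (fun _ => rfl))
  erw [Q.post_perm] at h
  refine h.trans ?_
  erw [Q.comp_id, Q.perm_perm]
  exact Q.perm_refl f

theorem act_act {ι κ ν : Type} (e : ι ≃ κ) (e' : κ ≃ ν) {x : ι → Q.Obj} {x' : κ → Q.Obj}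
    {x'' : ν → Q.Obj} {y y' y'' : Q.Obj}
    (a : ∀ i, x' (e i) ⟶ x i) (a' : ∀ i, x'' (e' i) ⟶ x' i) (b : y ⟶ y') (b' : y' ⟶ y'')
    (f : Q.Hom x y) :
    Q.act e' a' b' (Q.act e a b f) = Q.act (e.trans e') (fun i => a' (e i) ≫ a i) (b ≫ b') f := by
  unfold act
  erw [Q.perm_comp_left _ _ _ _ (fun p => Q.incl (a' (e p.1))) (fun _ => HEq.rfl), Q.comp_post,
    Q.assoc f (fun i => Q.incl (a i)) (fun i _ => Q.incl (a' (e i)))]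
  simp only [Q.incl_comp]
  erw [Q.comp_perm_right (fun _ : ι => (Equiv.uniqueSigma (fun _ : Unit => Unit)).symm) _
    (fun i => Q.incl (a' (e i) ≫ a i)) (fun _ _ => rfl)]
  erw [Q.post_perm, Q.post_post, Q.post_perm, Q.post_perm, Q.perm_perm, Q.perm_perm, Q.perm_perm]
  rfl


/-- An arrow of `Q` together with its source, a list of objects, and its target. -/
structure Arrow where
  arity : ℕ
  src : Fin arity → Q.Obj
  tgt : Q.Obj
  arr : Q.Hom src tgt

variable {Q}

/-- A morphism of arrows: a morphism of their sources (a permutation of the list, together with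
object-morphisms) and of their targets, the action of which sends `A.arr` to `B.arr`. -/
@[ext]
structure ArrowHom (A B : Q.Arrow) where
  perm : Fin A.arity ≃ Fin B.arity
  srcHom : ∀ i, B.src (perm i) ⟶ A.src i
  tgtHom : A.tgt ⟶ B.tgt
  act_eq : Q.act perm srcHom tgtHom A.arr = B.arr

/-- The category `elt(Q)` of arrows of `Q`. -/
instance : SmallCategory Q.Arrow where
  Hom := ArrowHom
  id A := ⟨Equiv.refl _, fun i => 𝟙 (A.src i), 𝟙 A.tgt, Q.act_id A.arr⟩
  comp {A B C} α β := ⟨α.perm.trans β.perm, fun i => β.srcHom (α.perm i) ≫ α.srcHom i,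
    α.tgtHom ≫ β.tgtHom, by rw [← β.act_eq, ← α.act_eq]; exact (Q.act_act _ _ _ _ _ _ _).symm⟩
  id_comp α := by
    refine ArrowHom.ext rfl (heq_of_eq ?_) (Category.id_comp _)
    funext i; exact Category.comp_id _
  comp_id α := by
    refine ArrowHom.ext rfl (heq_of_eq ?_) (Category.comp_id _)
    funext i; exact Category.id_comp _
  assoc α β γ := by
    refine ArrowHom.ext rfl (heq_of_eq ?_) (Category.assoc _ _ _)
    funext i; exact (Category.assoc _ _ _).symm

/-- Planar trees with nodes labelled by the arrows `A n` of `Q` and edges labelled by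
object-morphisms, with leaves labelled by the objects `z l`.  `edge l a` is the tree without nodes,
whose only edge is labelled by `a` and is at the same time the leaf `l`.
`node n a ts` has a lowest node labelled by `A n`, whose outgoing edge is labelled by `a`, and
above its `i`-th input the tree `ts i`, whose lowest edge is the `i`-th incoming edge.
The index is the codomain of the label of the lowest edge. -/
inductive Tree {N L : Type} (A : N → Q.Arrow) (z : L → Q.Obj) : Q.Obj → Type
  | edge (l : L) {y : Q.Obj} (a : z l ⟶ y) : Tree A z y
  | node (n : N) {y : Q.Obj} (a : (A n).tgt ⟶ y)
      (ts : ∀ i : Fin (A n).arity, Tree A z ((A n).src i)) : Tree A z y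

namespace Tree

/-- The set of leaves of a tree. -/
def Leaves {N L : Type} {A : N → Q.Arrow} {z : L → Q.Obj} : {y : Q.Obj} → Tree A z y → Type
  | _, edge _ _ => Unit
  | _, node _ _ ts => Σ i, (ts i).Leaves

/-- The set of nodes of a tree. -/
def Nodes {N L : Type} {A : N → Q.Arrow} {z : L → Q.Obj} : {y : Q.Obj} → Tree A z y → Type
  | _, edge _ _ => Empty
  | _, node _ _ ts => Unit ⊕ Σ i, (ts i).Nodes

/-- The label of a leaf. -/
def leafIdx {N L : Type} {A : N → Q.Arrow} {z : L → Q.Obj} :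
    {y : Q.Obj} → (t : Tree A z y) → t.Leaves → L
  | _, edge l _ => fun _ => l
  | _, node _ _ ts => fun p => (ts p.1).leafIdx p.2

/-- The label of a node. -/
def nodeIdx {N L : Type} {A : N → Q.Arrow} {z : L → Q.Obj} :
    {y : Q.Obj} → (t : Tree A z y) → t.Nodes → N
  | _, edge _ _ => Empty.elim
  | _, node n _ ts => Sum.elim (fun _ => n) (fun p => (ts p.1).nodeIdx p.2)

/-- The arrow of `Q` that results from composing the labels of the nodes according to their positions in
the tree, with the labels `a` of the edges acting as the arrows `ι(a)`. -/
def eval {N L : Type} {A : N → Q.Arrow} {z : L → Q.Obj} :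
    {y : Q.Obj} → (t : Tree A z y) → Q.Hom (fun l : t.Leaves => z (t.leafIdx l)) y
  | _, edge _ a => Q.incl a
  | _, node n a ts => Q.post a (Q.comp (A n).arr (fun i => (ts i).eval))

/-- Compose the label of the lowest edge with an object-morphism. -/
def rootComp {N L : Type} {A : N → Q.Arrow} {z : L → Q.Obj} {y y' : Q.Obj} (b : y ⟶ y') :
    Tree A z y → Tree A z y'
  | edge l a => edge l (a ≫ b)
  | node n a ts => node n (a ≫ b) ts

/-- Graft the tree `u l` on each leaf labelled by `l`, composing the labels of the two edges that are
joined, and relabel the nodes of the lower tree along `φ`. -/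
def graft {N N' L L' : Type} {A : N → Q.Arrow} {z : L → Q.Obj} {z' : L' → Q.Obj}
    (φ : N' → N) (u : ∀ l, Tree A z (z' l)) :
    {y : Q.Obj} → Tree (fun n => A (φ n)) z' y → Tree A z y
  | _, edge l a => (u l).rootComp a
  | _, node n a ts => node (φ n) a (fun i => graft φ u (ts i))

/-- Relabel the nodes of a tree. -/
def relabel {N N' L : Type} {A : N → Q.Arrow} {z : L → Q.Obj} (φ : N' → N) :
    {y : Q.Obj} → Tree (fun n => A (φ n)) z y → Tree A z y
  | _, edge l a => edge l a
  | _, node n a ts => node (φ n) a (fun i => relabel φ (ts i))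

instance finite_leaves {N L : Type} {A : N → Q.Arrow} {z : L → Q.Obj} {y : Q.Obj}
    (t : Tree A z y) : Finite t.Leaves := by
  induction t with
  | edge l a => exact inferInstanceAs (Finite Unit)
  | node n a ts ih => exact inferInstanceAs (Finite (Σ i, (ts i).Leaves))

instance finite_nodes {N L : Type} {A : N → Q.Arrow} {z : L → Q.Obj} {y : Q.Obj}
    (t : Tree A z y) : Finite t.Nodes := by
  induction t with
  | edge l a => exact inferInstanceAs (Finite Empty)
  | node n a ts ih => exact inferInstanceAs (Finite (Unit ⊕ Σ i, (ts i).Nodes))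

variable {N N' L L' : Type} {A : N → Q.Arrow} {z : L → Q.Obj} {z' : L' → Q.Obj}

theorem rootComp_leaves {y y' : Q.Obj} (b : y ⟶ y') (t : Tree A z y) :
    ∃ (E : t.Leaves ≃ (t.rootComp b).Leaves) (h : ∀ l, t.leafIdx l = (t.rootComp b).leafIdx (E l)),
      (t.rootComp b).eval = Q.perm E (Q.post b t.eval) (fun l => congrArg z (h l)) := by
  cases t with
  | edge l a =>
    refine ⟨Equiv.refl Unit, fun _ => rfl, ?_⟩
    refine Eq.trans ?_ (Q.perm_refl _).symm
    simp only [eval, post]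
    erw [Q.incl_comp, Q.perm_perm]
    exact (Q.perm_refl _).symm
  | node n a ts =>
    refine ⟨Equiv.refl _, fun _ => rfl, ?_⟩
    refine Eq.trans ?_ (Q.perm_refl _).symm
    exact (Q.post_post _ _ _).symm

theorem rootComp_nodes {y y' : Q.Obj} (b : y ⟶ y') (t : Tree A z y) :
    ∃ E : t.Nodes ≃ (t.rootComp b).Nodes, ∀ n, t.nodeIdx n = (t.rootComp b).nodeIdx (E n) := by
  cases t with
  | edge l a => exact ⟨Equiv.refl _, fun _ => rfl⟩
  | node n a ts => exact ⟨Equiv.refl _, fun _ => rfl⟩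

theorem relabel_leaves (φ : N' → N) {y : Q.Obj} (t : Tree (fun n => A (φ n)) z y) :
    ∃ (E : t.Leaves ≃ (t.relabel φ).Leaves)
      (h : ∀ l, t.leafIdx l = (t.relabel φ).leafIdx (E l)),
      (t.relabel φ).eval = Q.perm E t.eval (fun l => congrArg z (h l)) := by
  induction t with
  | edge l a => exact ⟨Equiv.refl _, fun _ => rfl, (Q.perm_refl _).symm⟩
  | node n a ts ih =>
    choose E h H using ih
    refine ⟨Equiv.sigmaCongrRight E, fun p => h p.1 p.2, ?_⟩
    refine Eq.trans ?_ (Q.post_perm _ _ _ _)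
    refine congrArg (Q.post a) ?_
    refine Eq.trans (congrArg (Q.comp (A (φ n)).arr) (funext H)) ?_
    exact Q.comp_perm_right _ _ _ _

theorem relabel_nodes (φ : N' → N) {y : Q.Obj} (t : Tree (fun n => A (φ n)) z y) :
    ∃ E : t.Nodes ≃ (t.relabel φ).Nodes,
      ∀ n, φ (t.nodeIdx n) = (t.relabel φ).nodeIdx (E n) := by
  induction t with
  | edge l a => exact ⟨Equiv.refl _, fun e => e.elim⟩
  | node n a ts ih =>
    choose E h using ih
    refine ⟨(Equiv.refl Unit).sumCongr (Equiv.sigmaCongrRight E), ?_⟩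
    rintro (u | p)
    · rfl
    · exact h p.1 p.2

theorem graft_leaves (φ : N' → N) (u : ∀ l, Tree A z (z' l)) {y : Q.Obj}
    (t : Tree (fun n => A (φ n)) z' y) :
    ∃ (E : (Σ l, (u (t.leafIdx l)).Leaves) ≃ (graft φ u t).Leaves)
      (h : ∀ p, (u (t.leafIdx p.1)).leafIdx p.2 = (graft φ u t).leafIdx (E p)),
      (graft φ u t).eval =
        Q.perm E (Q.comp t.eval (fun l => (u (t.leafIdx l)).eval)) (fun p => congrArg z (h p)) := by
  induction t with
  | edge l a =>
    obtain ⟨E, h, H⟩ := rootComp_leaves a (u l)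
    refine ⟨(Equiv.uniqueSigma (fun _ : Unit => (u l).Leaves)).trans E, fun p => h p.2, ?_⟩
    refine H.trans ?_
    exact Q.perm_perm _ _ _ _ _
  | node n a ts ih =>
    choose E h H using ih
    refine ⟨(Equiv.sigmaAssoc fun i l => (u ((ts i).leafIdx l)).Leaves).trans
      (Equiv.sigmaCongrRight E), fun p => h p.1.1 ⟨p.1.2, p.2⟩, ?_⟩
    have key : Q.comp (A (φ n)).arr (fun i => (graft φ u (ts i)).eval) =
        Q.perm (Equiv.sigmaCongrRight E) (Q.comp (A (φ n)).arr (fun i =>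
          Q.comp (ts i).eval (fun l => (u ((ts i).leafIdx l)).eval)))
          (fun p => congrArg z (h p.1 p.2)) := by
      refine Eq.trans (congrArg (Q.comp (A (φ n)).arr) (funext H)) ?_
      exact Q.comp_perm_right _ _ _ _
    have key2 := Q.assoc (A (φ n)).arr (fun i => (ts i).eval)
      (fun i l => (u ((ts i).leafIdx l)).eval)
    refine Eq.trans (congrArg (Q.post a) key) ?_
    refine Eq.trans (Q.post_perm _ _ _ _) ?_
    have key3 := Q.comp_post a (Q.comp (A (φ n)).arr (fun i => (ts i).eval))
      (fun p => (u ((ts p.1).leafIdx p.2)).eval)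
    refine Eq.trans ?_ (congrArg (fun s => Q.perm ((Equiv.sigmaAssoc fun i l =>
      (u ((ts i).leafIdx l)).Leaves).trans (Equiv.sigmaCongrRight E)) s
        (fun p => congrArg z (h p.1.1 ⟨p.1.2, p.2⟩))) key3.symm)
    erw [key2, Q.post_perm]
    refine Eq.trans ?_ (Q.perm_perm _ _ _ _ _).symm
    exact Q.perm_congr (fun _ => rfl) _ _

theorem graft_nodes (φ : N' → N) (u : ∀ l, Tree A z (z' l)) {y : Q.Obj}
    (t : Tree (fun n => A (φ n)) z' y) :
    ∃ E : (t.Nodes ⊕ Σ l, (u (t.leafIdx l)).Nodes) ≃ (graft φ u t).Nodes,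
      (∀ n, φ (t.nodeIdx n) = (graft φ u t).nodeIdx (E (Sum.inl n))) ∧
      (∀ p, (u (t.leafIdx p.1)).nodeIdx p.2 = (graft φ u t).nodeIdx (E (Sum.inr p))) := by
  induction t with
  | edge l a =>
    obtain ⟨E, h⟩ := rootComp_nodes a (u l)
    refine ⟨(Equiv.emptySum Empty _).trans
      ((Equiv.uniqueSigma (fun _ : Unit => (u l).Nodes)).trans E), fun e => e.elim, fun p => h p.2⟩
  | node n a ts ih =>
    choose E h h' using ih
    let F : ((Unit ⊕ Σ i, (ts i).Nodes) ⊕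
        Σ p : (Σ i, (ts i).Leaves), (u ((ts p.1).leafIdx p.2)).Nodes) ≃
        (Unit ⊕ Σ i, (graft φ u (ts i)).Nodes) :=
      (Equiv.sumAssoc _ _ _).trans ((Equiv.refl Unit).sumCongr
        (((Equiv.refl _).sumCongr
          (Equiv.sigmaAssoc fun i l => (u ((ts i).leafIdx l)).Nodes)).trans
        ((Equiv.sigmaSumDistrib _ _).symm.trans (Equiv.sigmaCongrRight E))))
    refine ⟨F, ?_, ?_⟩
    · rintro (v | p)
      · rfl
      · exact h p.1 p.2
    · rintro ⟨⟨i, l⟩, m⟩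
      exact h' i ⟨l, m⟩

end Tree

/-- The arrows of the slice: configurations for composing the arrows `A n` to yield `B`.  These are
trees with nodes in bijection with the indices `n` of the `A n`, and leaves in bijection with the
source of `B` (the twist at the top of the tree), that evaluate to `B`. -/
@[ext]
structure Config {N : Type} (A : N → Q.Arrow) (B : Q.Arrow) where
  tree : Tree A B.src B.tgt
  nodes : Function.Bijective tree.nodeIdx
  leaves : Function.Bijective tree.leafIdx
  eval_eq : Q.perm (Equiv.ofBijective _ leaves) tree.eval (fun _ => rfl) = B.arr

namespace Tree

variable {N N' L L' : Type} {A : N → Q.Arrow} {z : L → Q.Obj} {z' : L' → Q.Obj}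

/-- Replace each node, labelled by `x i`, of a tree by a configuration `g i` for composing arrows to
yield `x i`. -/
def subst {I : Type} {K : I → Type} {x : I → Q.Arrow} {w : ∀ i, K i → Q.Arrow}
    (g : ∀ i, Config (w i) (x i)) :
    {y : Q.Obj} → Tree x z y → Tree (fun p : Σ i, K i => w p.1 p.2) z y
  | _, edge l a => edge l a
  | _, node i a ts =>
      (graft (A := fun p : Σ i, K i => w p.1 p.2) (Sigma.mk i) (fun l => subst g (ts l))
        (g i).tree).rootComp a

variable {I : Type} {K : I → Type} {x : I → Q.Arrow} {w : ∀ i, K i → Q.Arrow}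

theorem subst_leaves (g : ∀ i, Config (w i) (x i)) {y : Q.Obj} (t : Tree x z y) :
    ∃ (E : t.Leaves ≃ (subst g t).Leaves) (h : ∀ l, t.leafIdx l = (subst g t).leafIdx (E l)),
      (subst g t).eval = Q.perm E t.eval (fun l => congrArg z (h l)) := by
  induction t with
  | edge l a => exact ⟨Equiv.refl _, fun _ => rfl, (Q.perm_refl _).symm⟩
  | node i a ts ih =>
    choose E h H using ih
    obtain ⟨E₁, h₁, H₁⟩ := graft_leaves (A := fun p : Σ i, K i => w p.1 p.2) (Sigma.mk i)
      (fun l => subst g (ts l)) (g i).tree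
    obtain ⟨E₂, h₂, H₂⟩ := rootComp_leaves a (graft (A := fun p : Σ i, K i => w p.1 p.2) (Sigma.mk i)
      (fun l => subst g (ts l)) (g i).tree)
    let e := Equiv.ofBijective _ (g i).leaves
    let F : (Σ l, (ts l).Leaves) ≃ (subst g (node i a ts)).Leaves :=
      (Equiv.sigmaCongrLeft (β := fun l => (ts l).Leaves) e).symm.trans
        ((Equiv.sigmaCongrRight fun l => E ((g i).tree.leafIdx l)).trans (E₁.trans E₂))
    have hF : ∀ q, F (Equiv.sigmaCongrLeft (β := fun l => (ts l).Leaves) e q) =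
        E₂ (E₁ ⟨q.1, E _ q.2⟩) := by
      intro q
      exact congrArg (fun r => E₂ (E₁ ((Equiv.sigmaCongrRight fun l =>
        E ((g i).tree.leafIdx l)) r))) (Equiv.symm_apply_apply _ q)
    have hh : ∀ p : Σ l, (ts l).Leaves, (ts p.1).leafIdx p.2 =
        (subst g (node i a ts)).leafIdx (F p) := by
      intro p
      obtain ⟨q, rfl⟩ := (Equiv.sigmaCongrLeft (β := fun l => (ts l).Leaves) e).surjective p
      rw [hF]
      exact (h _ q.2).trans ((h₁ ⟨q.1, E _ q.2⟩).trans (h₂ _))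
    refine ⟨F, hh, ?_⟩
    refine H₂.trans ?_
    have k1 : Q.comp (g i).tree.eval
        (fun l => (subst g (ts ((g i).tree.leafIdx l))).eval) =
        Q.perm (Equiv.sigmaCongrRight fun l => E ((g i).tree.leafIdx l))
          (Q.comp (g i).tree.eval (fun l => (ts ((g i).tree.leafIdx l)).eval))
          (fun p => congrArg z (h _ p.2)) := by
      refine Eq.trans (congrArg (Q.comp (g i).tree.eval)
        (funext fun l => H ((g i).tree.leafIdx l))) ?_
      exact Q.comp_perm_right _ _ _ _
    have k2 : Q.comp (x i).arr (fun l => (ts l).eval) =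
        Q.perm (Equiv.sigmaCongrLeft (β := fun l => (ts l).Leaves) e)
          (Q.comp (g i).tree.eval (fun l => (ts ((g i).tree.leafIdx l)).eval))
          (fun _ => rfl) := by
      rw [← (g i).eval_eq]
      exact Q.perm_comp_left _ _ _ _ _ (fun _ => HEq.rfl)
    have l1 : Q.post a (graft (A := fun p : Σ i, K i => w p.1 p.2) (Sigma.mk i)
        (fun l => subst g (ts l)) (g i).tree).eval =
        Q.perm ((Equiv.sigmaCongrRight fun l => E ((g i).tree.leafIdx l)).trans E₁)
          (Q.post a (Q.comp (g i).tree.eval (fun l => (ts ((g i).tree.leafIdx l)).eval)))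
          (fun p => congrArg z ((h _ p.2).trans (h₁ ⟨p.1, E _ p.2⟩))) := by
      refine Eq.trans (congrArg (Q.post a) H₁) ?_
      rw [k1]
      refine Eq.trans (congrArg (Q.post a) (Q.perm_perm _ _ _ _ _)) ?_
      exact Q.post_perm _ _ _ _
    have l2 : (node i a ts).eval = Q.perm (Equiv.sigmaCongrLeft (β := fun l => (ts l).Leaves) e)
          (Q.post a (Q.comp (g i).tree.eval (fun l => (ts ((g i).tree.leafIdx l)).eval)))
          (fun _ => rfl) :=
      Eq.trans (congrArg (Q.post a) k2) (Q.post_perm _ _ _ _)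
    rw [l1]
    refine Eq.trans (Q.perm_perm _ _ _ _ _) ?_
    refine Eq.trans ?_ (congrArg (fun s => Q.perm F s (fun p => congrArg z (hh p))) l2.symm)
    refine Eq.trans ?_ (Q.perm_perm _ _ _ _ _).symm
    exact Q.perm_congr (fun q => (hF q).symm) _ _

theorem subst_nodes (g : ∀ i, Config (w i) (x i)) {y : Q.Obj} (t : Tree x z y) :
    ∃ E : (Σ n, (g (t.nodeIdx n)).tree.Nodes) ≃ (subst g t).Nodes,
      ∀ p, (⟨t.nodeIdx p.1, (g (t.nodeIdx p.1)).tree.nodeIdx p.2⟩ : Σ i, K i) =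
        (subst g t).nodeIdx (E p) := by
  induction t with
  | edge l a =>
    have : IsEmpty (edge (A := x) l a).Nodes := inferInstanceAs (IsEmpty Empty)
    have : IsEmpty (subst g (edge (A := x) l a)).Nodes := inferInstanceAs (IsEmpty Empty)
    exact ⟨Equiv.equivOfIsEmpty _ _, fun ⟨n, _⟩ => Empty.elim n⟩
  | node i a ts ih =>
    choose E h using ih
    obtain ⟨E₁, h₁, h₁'⟩ := graft_nodes (A := fun p : Σ i, K i => w p.1 p.2) (Sigma.mk i)
      (fun l => subst g (ts l)) (g i).tree
    obtain ⟨E₂, h₂⟩ := rootComp_nodes a (graft (A := fun p : Σ i, K i => w p.1 p.2) (Sigma.mk i)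
      (fun l => subst g (ts l)) (g i).tree)
    let e := Equiv.ofBijective _ (g i).leaves
    let G := Equiv.sigmaCongrLeft (β := fun l => (subst g (ts l)).Nodes) e
    let F : (Σ n : (node i a ts).Nodes, (g ((node i a ts).nodeIdx n)).tree.Nodes) ≃
        (subst g (node i a ts)).Nodes :=
      (Equiv.sumSigmaDistrib
        (fun n : Unit ⊕ Σ l, (ts l).Nodes => (g ((node i a ts).nodeIdx n)).tree.Nodes)).trans
      (((Equiv.uniqueSigma (fun _ : Unit => (g i).tree.Nodes)).sumCongr
        ((Equiv.sigmaAssoc fun l n => (g ((ts l).nodeIdx n)).tree.Nodes).trans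
          ((Equiv.sigmaCongrRight E).trans G.symm))).trans (E₁.trans E₂))
    refine ⟨F, ?_⟩
    rintro ⟨v | ⟨l, n⟩, m⟩
    · exact (h₁ m).trans (h₂ _)
    · refine (h l ⟨n, m⟩).trans ?_
      have hG : G (G.symm ⟨l, E l ⟨n, m⟩⟩) = ⟨l, E l ⟨n, m⟩⟩ := Equiv.apply_symm_apply _ _
      have e1 := h₁' (G.symm ⟨l, E l ⟨n, m⟩⟩)
      have e2 : ∀ r : Σ l, (subst g (ts l)).Nodes, r = ⟨l, E l ⟨n, m⟩⟩ →
          (subst g (ts l)).nodeIdx (E l ⟨n, m⟩) = (subst g (ts r.1)).nodeIdx r.2 := by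
        rintro _ rfl; rfl
      exact (e2 _ hG).trans (e1.trans (h₂ _))

end Tree

namespace Config

/-- The tree with one node that corresponds to a morphism of arrows. -/
def ofHom {A B : Q.Arrow} (α : A ⟶ B) : Config (fun _ : Unit => A) B where
  tree := .node () α.tgtHom (fun i => .edge (α.perm i) (α.srcHom i))
  nodes := by
    constructor
    · rintro (_ | ⟨_, ⟨⟩⟩) (_ | ⟨_, ⟨⟩⟩) _
      rfl
    · intro u
      exact ⟨Sum.inl (), rfl⟩
  leaves := ((Equiv.sigmaPUnit (Fin A.arity)).trans α.perm).bijective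
  eval_eq := by
    refine Eq.trans ?_ α.act_eq
    have key := Q.perm_congr (x' := B.src)
      (e := Equiv.ofBijective (fun p : Σ _ : Fin A.arity, Unit => α.perm p.1)
        ((Equiv.sigmaPUnit (Fin A.arity)).trans α.perm).bijective)
      (e' := (Equiv.sigmaPUnit (Fin A.arity)).trans α.perm) (fun _ => rfl)
      (Q.post α.tgtHom (Q.comp A.arr (fun i => Q.incl (α.srcHom i)))) (fun _ => rfl)
    exact key

/-- Relabel the nodes of a configuration along a bijection. -/
def relabel {N N' : Type} (e : N ≃ N') {A : N' → Q.Arrow} {B : Q.Arrow}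
    (c : Config (fun n => A (e n)) B) : Config A B where
  tree := c.tree.relabel e
  nodes := by
    obtain ⟨E, h⟩ := c.tree.relabel_nodes e
    have : (c.tree.relabel e).nodeIdx = e ∘ c.tree.nodeIdx ∘ E.symm := by
      funext m
      obtain ⟨n, rfl⟩ := E.surjective m
      simp [← h]
    rw [this]
    exact e.bijective.comp (c.nodes.comp E.symm.bijective)
  leaves := by
    obtain ⟨E, h, -⟩ := c.tree.relabel_leaves e
    have : (c.tree.relabel e).leafIdx = c.tree.leafIdx ∘ E.symm := by
      funext m
      obtain ⟨n, rfl⟩ := E.surjective m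
      simp [← h]
    rw [this]
    exact c.leaves.comp E.symm.bijective
  eval_eq := by
    obtain ⟨E, h, H⟩ := c.tree.relabel_leaves e
    rw [← c.eval_eq]
    refine Eq.trans (congrArg (fun s => Q.perm _ s _) H) ?_
    refine (Q.perm_perm _ _ _ _ _).trans ?_
    exact Q.perm_congr (fun l => (h l).symm) _ _

/-- The symmetric action of the slice. -/
def perm {N N' : Type} (e : N ≃ N') {A : N → Q.Arrow} {A' : N' → Q.Arrow} {B : Q.Arrow}
    (c : Config A B) (h : ∀ n, A n = A' (e n)) : Config A' B :=
  relabel e ((funext h : A = fun n => A' (e n)) ▸ c)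

/-- Composition of the slice: replace the nodes of `f` by the configurations `g i`. -/
def comp {I : Type} {K : I → Type} {x : I → Q.Arrow} {B : Q.Arrow} {w : ∀ i, K i → Q.Arrow}
    (f : Config x B) (g : ∀ i, Config (w i) (x i)) :
    Config (fun p : Σ i, K i => w p.1 p.2) B where
  tree := f.tree.subst g
  nodes := by
    obtain ⟨E, h⟩ := Tree.subst_nodes g f.tree
    let F : (Σ n, (g (f.tree.nodeIdx n)).tree.Nodes) ≃ Σ i, K i :=
      (Equiv.sigmaCongrRight fun n => Equiv.ofBijective _ (g (f.tree.nodeIdx n)).nodes).trans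
        (Equiv.sigmaCongrLeft (Equiv.ofBijective _ f.nodes))
    have : (f.tree.subst g).nodeIdx = F ∘ E.symm := by
      funext m
      obtain ⟨n, rfl⟩ := E.surjective m
      rw [← h, Function.comp_apply, Equiv.symm_apply_apply]
      rfl
    rw [this]
    exact F.bijective.comp E.symm.bijective
  leaves := by
    obtain ⟨E, h, -⟩ := Tree.subst_leaves g f.tree
    have : (f.tree.subst g).leafIdx = f.tree.leafIdx ∘ E.symm := by
      funext m
      obtain ⟨n, rfl⟩ := E.surjective m
      simp [← h]
    rw [this]
    exact f.leaves.comp E.symm.bijective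
  eval_eq := by
    obtain ⟨E, h, H⟩ := Tree.subst_leaves g f.tree
    rw [← f.eval_eq]
    refine Eq.trans (congrArg (fun s => Q.perm _ s _) H) ?_
    refine (Q.perm_perm _ _ _ _ _).trans ?_
    exact Q.perm_congr (fun l => (h l).symm) _ _


end Config

namespace Tree

theorem rootComp_id {N L : Type} {A : N → Q.Arrow} {z : L → Q.Obj} {y : Q.Obj} (t : Tree A z y) :
    t.rootComp (𝟙 y) = t := by
  cases t <;> simp [rootComp]

theorem rootComp_rootComp {N L : Type} {A : N → Q.Arrow} {z : L → Q.Obj} {y y' y'' : Q.Obj}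
    (b : y ⟶ y') (b' : y' ⟶ y'') (t : Tree A z y) :
    (t.rootComp b).rootComp b' = t.rootComp (b ≫ b') := by
  cases t <;> simp [rootComp]

theorem relabel_rootComp {N N' L : Type} {A : N → Q.Arrow} {z : L → Q.Obj} (φ : N' → N)
    {y y' : Q.Obj} (b : y ⟶ y') (t : Tree (fun n => A (φ n)) z y) :
    (t.rootComp b).relabel φ = (t.relabel φ).rootComp b := by
  cases t <;> rfl

theorem relabel_id {N L : Type} {A : N → Q.Arrow} {z : L → Q.Obj} {y : Q.Obj} (t : Tree A z y) :
    relabel (A := A) id t = t := by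
  induction t with
  | edge l a => rfl
  | node n a ts ih => exact congrArg (node n a) (funext ih)

theorem relabel_relabel {N N' N'' L : Type} {A : N → Q.Arrow} {z : L → Q.Obj} (φ : N' → N)
    (ψ : N'' → N') {y : Q.Obj} (t : Tree (fun n => A (φ (ψ n))) z y) :
    relabel φ (relabel (A := fun n => A (φ n)) ψ t) = relabel (A := A) (fun n => φ (ψ n)) t := by
  induction t with
  | edge l a => rfl
  | node n a ts ih => exact congrArg (node (φ (ψ n)) a) (funext ih)

theorem graft_edge {N N' L : Type} {A : N → Q.Arrow} {z : L → Q.Obj} (φ : N' → N)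
    {y : Q.Obj} (t : Tree (fun n => A (φ n)) z y) :
    graft φ (fun l => edge l (𝟙 (z l))) t = relabel φ t := by
  induction t with
  | edge l a => simp [graft, relabel, rootComp]
  | node n a ts ih => exact congrArg (node (φ n) a) (funext ih)

theorem graft_rootComp {N N' L L' : Type} {A : N → Q.Arrow} {z : L → Q.Obj} {z' : L' → Q.Obj}
    (φ : N' → N) (u : ∀ l, Tree A z (z' l)) {y y' : Q.Obj} (b : y ⟶ y')
    (t : Tree (fun n => A (φ n)) z' y) :
    graft φ u (t.rootComp b) = (graft φ u t).rootComp b := by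
  cases t with
  | edge l a => exact (rootComp_rootComp _ _ _).symm
  | node n a ts => rfl

theorem graft_relabel {N N' N'' L L' : Type} {A : N → Q.Arrow} {z : L → Q.Obj} {z' : L' → Q.Obj}
    (φ : N' → N) (ψ : N'' → N') (u : ∀ l, Tree A z (z' l)) {y : Q.Obj}
    (t : Tree (fun n => A (φ (ψ n))) z' y) :
    graft φ u (relabel (A := fun n => A (φ n)) ψ t) =
      graft (A := A) (fun n => φ (ψ n)) u t := by
  induction t with
  | edge l a => rfl
  | node n a ts ih => exact congrArg (node (φ (ψ n)) a) (funext ih)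

theorem relabel_graft {M N N' L L' : Type} {A : M → Q.Arrow} {z : L → Q.Obj} {z' : L' → Q.Obj}
    (χ : N → M) (φ : N' → N) (u : ∀ l, Tree (fun n => A (χ n)) z (z' l)) {y : Q.Obj}
    (t : Tree (fun n => A (χ (φ n))) z' y) :
    relabel χ (graft (A := fun n => A (χ n)) φ u t) =
      graft (A := A) (fun n => χ (φ n)) (fun l => relabel χ (u l)) t := by
  induction t with
  | edge l a => exact relabel_rootComp _ _ _
  | node n a ts ih => exact congrArg (node (χ (φ n)) a) (funext ih)

theorem graft_graft {N N' N'' L L' L'' : Type} {A : N → Q.Arrow} {z : L → Q.Obj}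
    {z' : L' → Q.Obj} {z'' : L'' → Q.Obj} (φ : N' → N) (ψ : N'' → N')
    (u : ∀ l, Tree A z (z' l)) (v : ∀ l, Tree (fun n => A (φ n)) z' (z'' l)) {y : Q.Obj}
    (t : Tree (fun n => A (φ (ψ n))) z'' y) :
    graft φ u (graft (A := fun n => A (φ n)) ψ v t) =
      graft (A := A) (fun n => φ (ψ n)) (fun l => graft φ u (v l)) t := by
  induction t with
  | edge l a => exact graft_rootComp _ _ _ _
  | node n a ts ih => exact congrArg (node (φ (ψ n)) a) (funext ih)

variable {I : Type} {K : I → Type} {x : I → Q.Arrow} {w : ∀ i, K i → Q.Arrow}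

theorem subst_rootComp {L : Type} {z : L → Q.Obj} (g : ∀ i, Config (w i) (x i)) {y y' : Q.Obj}
    (b : y ⟶ y') (t : Tree x z y) : subst g (t.rootComp b) = (subst g t).rootComp b := by
  cases t with
  | edge l a => rfl
  | node i a ts => exact (rootComp_rootComp _ _ _).symm

theorem subst_id {L : Type} {z : L → Q.Obj} {y : Q.Obj} (t : Tree x z y) :
    subst (fun i => Config.ofHom (𝟙 (x i))) t =
      relabel (A := fun p : Σ _ : I, Unit => x p.1) (fun i => ⟨i, ()⟩) t := by
  induction t with
  | edge l a => rfl
  | node i a ts ih =>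
    refine congrArg₂ (node (A := fun p : Σ _ : I, Unit => x p.1) (⟨i, ()⟩ : Σ _ : I, Unit))
      (Category.id_comp a) (funext fun l => ?_)
    exact (rootComp_id _).trans (ih l)

theorem subst_relabel {I' : Type} {K : I' → Type} {x : I' → Q.Arrow} {w : ∀ i, K i → Q.Arrow}
    (e : I ≃ I') {L : Type} {z : L → Q.Obj} (g : ∀ i, Config (w i) (x i)) {y : Q.Obj}
    (t : Tree (fun i => x (e i)) z y) :
    subst g (relabel e t) =
      relabel (A := fun p : Σ i, K i => w p.1 p.2) (Equiv.sigmaCongrLeft e)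
        (subst (fun i => g (e i)) t) := by
  induction t with
  | edge l a => rfl
  | node i a ts ih =>
    refine Eq.trans ?_ (relabel_rootComp _ _ _).symm
    refine congrArg (rootComp a) ?_
    refine Eq.trans ?_ (relabel_graft (A := fun p : Σ i, K i => w p.1 p.2)
      (Equiv.sigmaCongrLeft e) _ _ _).symm
    exact congrArg (fun u => graft (A := fun p : Σ i, K i => w p.1 p.2) (Sigma.mk (e i)) u
      (g (e i)).tree) (funext ih)

theorem subst_relabel_right {K' : I → Type} {w : ∀ i, K' i → Q.Arrow} (e : ∀ i, K i ≃ K' i)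
    {L : Type} {z : L → Q.Obj} (g : ∀ i, Config (fun j => w i (e i j)) (x i)) {y : Q.Obj}
    (t : Tree x z y) :
    subst (fun i => Config.relabel (e i) (g i)) t =
      relabel (A := fun p : Σ i, K' i => w p.1 p.2) (Equiv.sigmaCongrRight e) (subst g t) := by
  induction t with
  | edge l a => rfl
  | node i a ts ih =>
    refine Eq.trans ?_ (relabel_rootComp _ _ _).symm
    refine congrArg (rootComp a) ?_
    refine Eq.trans ?_ (relabel_graft (A := fun p : Σ i, K' i => w p.1 p.2)
      (Equiv.sigmaCongrRight e) _ _ _).symm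
    refine Eq.trans ?_ (congrArg (fun u => graft (A := fun p : Σ i, K' i => w p.1 p.2)
      (fun j => (⟨i, e i j⟩ : Σ i, K' i)) u (g i).tree) (funext ih))
    exact graft_relabel (A := fun p : Σ i, K' i => w p.1 p.2) (Sigma.mk i) (e i) _ _

theorem subst_graft {N' L L' : Type} {z : L → Q.Obj} {z' : L' → Q.Obj} (φ : N' → I)
    (g : ∀ i, Config (w i) (x i)) (u : ∀ l, Tree x z (z' l)) {y : Q.Obj}
    (t : Tree (fun n => x (φ n)) z' y) :
    subst g (graft φ u t) =
      graft (A := fun p : Σ i, K i => w p.1 p.2)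
        (fun p : Σ n, K (φ n) => (⟨φ p.1, p.2⟩ : Σ i, K i)) (fun l => subst g (u l))
        (subst (fun n => g (φ n)) t) := by
  induction t with
  | edge l a => exact subst_rootComp _ _ _
  | node n a ts ih =>
    refine Eq.trans ?_ (graft_rootComp _ _ _ _).symm
    refine congrArg (rootComp a) ?_
    refine Eq.trans ?_ (graft_graft (A := fun p : Σ i, K i => w p.1 p.2)
      (fun p : Σ n, K (φ n) => (⟨φ p.1, p.2⟩ : Σ i, K i)) (Sigma.mk n) _ _ _).symm
    exact congrArg (fun v => graft (A := fun p : Σ i, K i => w p.1 p.2) (Sigma.mk (φ n)) v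
      (g (φ n)).tree) (funext ih)

theorem subst_subst {ν : ∀ i, K i → Type} {v : ∀ i j, ν i j → Q.Arrow}
    {L : Type} {z : L → Q.Obj} (g : ∀ i, Config (w i) (x i))
    (h : ∀ i j, Config (v i j) (w i j)) {y : Q.Obj} (t : Tree x z y) :
    subst (fun p : Σ i, K i => h p.1 p.2) (subst g t) =
      relabel (A := fun q : Σ p : Σ i, K i, ν p.1 p.2 => v q.1.1 q.1.2 q.2)
        (Equiv.sigmaAssoc ν).symm (subst (fun i => Config.comp (g i) (h i)) t) := by
  induction t with
  | edge l a => rfl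
  | node i a ts ih =>
    refine Eq.trans ?_ (relabel_rootComp _ _ _).symm
    refine (subst_rootComp _ _ _).trans (congrArg (rootComp a) ?_)
    refine Eq.trans ?_ (relabel_graft
      (A := fun q : Σ p : Σ i, K i, ν p.1 p.2 => v q.1.1 q.1.2 q.2)
      (Equiv.sigmaAssoc ν).symm _ _ _).symm
    refine (subst_graft _ _ _ _).trans ?_
    exact congrArg (fun u => graft (A := fun q : Σ p : Σ i, K i, ν p.1 p.2 => v q.1.1 q.1.2 q.2)
      (fun r : Σ j, ν i j => (⟨⟨i, r.1⟩, r.2⟩ : Σ p : Σ i, K i, ν p.1 p.2)) u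
      (subst (h i) (g i).tree)) (funext ih)

end Tree

/-- The slice `Q⁺`. -/
def slice (Q : SymMulticat) : SymMulticat where
  Obj := Q.Arrow
  Hom A B := Config A B
  finite_source c := Finite.of_surjective _ c.nodes.surjective
  incl α := Config.ofHom α
  comp f g := Config.comp f g
  perm e _ _ _ c h := Config.perm e c h
  id_comp {ι x y} f := by
    refine Config.ext ?_
    refine (Tree.rootComp_id _).trans ?_
    exact Tree.graft_edge (A := fun p : Σ _ : Unit, ι => x p.2) (fun i => ⟨(), i⟩) f.tree
  comp_id f := Config.ext (Tree.subst_id f.tree)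
  assoc f g h := Config.ext (Tree.subst_subst g h f.tree)
  perm_refl f := Config.ext (Tree.relabel_id f.tree)
  perm_perm {_ _ _} e e' {x x' x'' y} f h h' := by
    obtain rfl : x' = fun i => x'' (e' i) := funext h'
    obtain rfl : x = fun i => x'' (e' (e i)) := funext h
    exact Config.ext (Tree.relabel_relabel e' e f.tree)
  comp_perm_left {_ _ _} e {_ _ _} f g := Config.ext (Tree.subst_relabel e g f.tree)
  comp_perm_right {_ _ _} e {x y w w'} f g h := by
    obtain rfl : w = fun i j => w' i (e i j) := funext fun i => funext (h i)
    exact Config.ext (Tree.subst_relabel_right e g f.tree)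
  incl_comp {A B C} a b := by
    refine Config.ext ?_
    refine congrArg (Tree.node (A := fun _ : Σ _ : Unit, Unit => A)
      (⟨(), ()⟩ : Σ _ : Unit, Unit) (a.tgtHom ≫ b.tgtHom)) ?_
    rfl

/-- The symmetric multicategory `I` with precisely one object, precisely one (identity) object-morphism
and precisely one (identity) arrow: there is one arrow with a given source if the source has length
one, and none otherwise. -/
def unit : SymMulticat where
  Obj := Discrete Unit
  Hom {ι} _ _ := PLift (Nonempty (Unique ι))
  finite_source f := by
    obtain ⟨⟨_⟩⟩ := f
    infer_instance
  incl _ := ⟨⟨inferInstance⟩⟩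
  comp f g := ⟨by
    obtain ⟨⟨u⟩⟩ := f
    obtain ⟨⟨v⟩⟩ := g default
    exact ⟨(Equiv.uniqueSigma _).unique⟩⟩
  perm e _ _ _ f _ := ⟨by
    obtain ⟨⟨u⟩⟩ := f
    exact ⟨e.symm.unique⟩⟩
  id_comp _ := rfl
  comp_id _ := rfl
  assoc _ _ _ := rfl
  perm_refl _ := rfl
  perm_perm _ _ _ _ _ := by intros; rfl
  comp_perm_left _ _ _ := by intros; rfl
  comp_perm_right _ _ _ _ := by intros; rfl
  incl_comp _ _ := rfl

end SymMulticat

namespace SetMonad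

variable {S : Type} (T : Monad (Over S))

/-- The terminal object of `Set/S`. -/
abbrev one (S : Type) : Over S := Over.mk (𝟙 S)

/-- The map to the terminal object of `Set/S`. -/
abbrev bang (X : Over S) : X ⟶ one S := Over.homMk X.hom

/-- The object `T 1` of `Set/S`.  Its underlying set is the set of objects over which `T'` lives. -/
abbrev T1 : Over S := T.obj (one S)

variable {T}

/-- A set `A` over (the underlying set of) `T 1` is a graph `T 1 ← A → 1` in `Set/S`.
This is the object `A` of `Set/S`. -/
abbrev total (A : Over (T1 T).left) : Over S := Over.mk (A.hom ≫ (T1 T).hom)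

/-- The left leg `A → T 1` of the graph `T 1 ← A → 1`. -/
abbrev dom (A : Over (T1 T).left) : total A ⟶ T1 T := Over.homMk A.hom

/-- The map in `Set/S` underlying a map of graphs. -/
abbrev totalMap {A B : Over (T1 T).left} (f : A ⟶ B) : total A ⟶ total B :=
  Over.homMk f.left

/-- The composite of spans in `Set/S`, the pullback of `T X → T 1 ← A`: pairs of an element of `A` and a
compatible element of `T X`. -/
def after (A : Over (T1 T).left) (X : Over S) : Over S :=
  Over.mk (TypeCat.ofHom fun q : {q : (T.obj X).left × A.left //
    (T.map (bang X)).left q.1 = A.hom q.2} => (total A).hom q.1.2)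

theorem hom_bang {X Y : Over S} (f : X ⟶ Y) : f ≫ bang Y = bang X := by
  ext x
  exact ConcreteCategory.congr_hom (Over.w f) x

theorem map_bang {X Y : Over S} (f : X ⟶ Y) :
    T.map f ≫ T.map (bang Y) = T.map (bang X) := by
  rw [← T.map_comp, hom_bang]

namespace after

variable (A : Over (T1 T).left) (X : Over S)

/-- The projection of the pullback to `A`. -/
def snd : after A X ⟶ total A := Over.homMk (TypeCat.ofHom fun q => q.1.2)

/-- The projection of the pullback to `T X`. -/
def fst : after A X ⟶ T.obj X :=
  Over.homMk (TypeCat.ofHom fun q => q.1.1) (by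
    ext q
    have h1 := ConcreteCategory.congr_hom (Over.w (T.map (bang X))) q.1.1
    have h2 := congrArg (T1 T).hom q.2
    exact h1.symm.trans h2)

theorem condition : fst A X ≫ T.map (bang X) = snd A X ≫ dom A := by
  ext q
  exact q.2

variable {A X}

/-- The universal property of the pullback. -/
def lift {Y : Over S} (f : Y ⟶ T.obj X) (g : Y ⟶ total A)
    (h : f ≫ T.map (bang X) = g ≫ dom A) : Y ⟶ after A X :=
  Over.homMk (TypeCat.ofHom fun y => ⟨(f.left y, g.left y),
    ConcreteCategory.congr_hom (congrArg CommaMorphism.left h) y⟩) (by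
      ext y
      exact ConcreteCategory.congr_hom (Over.w g) y)

theorem lift_fst {Y : Over S} (f : Y ⟶ T.obj X) (g : Y ⟶ total A)
    (h : f ≫ T.map (bang X) = g ≫ dom A) : lift f g h ≫ fst A X = f := rfl

theorem lift_snd {Y : Over S} (f : Y ⟶ T.obj X) (g : Y ⟶ total A)
    (h : f ≫ T.map (bang X) = g ≫ dom A) : lift f g h ≫ snd A X = g := rfl

theorem hom_ext {Y : Over S} {f g : Y ⟶ after A X} (h₁ : f ≫ fst A X = g ≫ fst A X)
    (h₂ : f ≫ snd A X = g ≫ snd A X) : f = g := by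
  ext y
  have e₁ := ConcreteCategory.congr_hom (congrArg CommaMorphism.left h₁) y
  have e₂ := ConcreteCategory.congr_hom (congrArg CommaMorphism.left h₂) y
  exact Subtype.ext (Prod.ext e₁ e₂)

end after

variable (T)

/-- An `(E, T)`-operad for `E = Set/S`, that is, an `(E, T)`-multicategory whose object of objects is
terminal: a graph `T 1 ← A → 1` with identities `1 → A` and composition `A ∘ A → A` over `T 1`,
satisfying the identity and associativity laws. -/
structure Operad where
  graph : Over (T1 T).left
  ids : one S ⟶ total graph
  ids_dom : ids ≫ dom graph = T.η.app (one S)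
  comp : after graph (total graph) ⟶ total graph
  comp_dom : comp ≫ dom graph =
    after.fst graph (total graph) ≫ T.map (dom graph) ≫ T.μ.app (one S)
  ids_comp : after.lift (T.η.app (total graph)) (bang (total graph) ≫ ids)
    (by
      rw [Category.assoc, ids_dom]
      exact (T.η.naturality (bang (total graph))).symm) ≫ comp = 𝟙 (total graph)
  comp_ids : after.lift (dom graph ≫ T.map ids) (𝟙 (total graph))
    (by
      rw [Category.assoc, map_bang, Category.id_comp,
        show bang (one S) = 𝟙 (one S) from rfl, T.map_id, Category.comp_id]) ≫ comp =
      𝟙 (total graph)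
  assoc :
    after.lift (X := total graph)
      (after.fst graph (after graph (total graph)) ≫ T.map comp)
      (after.snd graph (after graph (total graph)))
      (by rw [Category.assoc, map_bang, after.condition]) ≫ comp =
    after.lift (X := total graph)
      (after.fst graph (after graph (total graph)) ≫
        T.map (after.fst graph (total graph)) ≫ T.μ.app (total graph))
      (after.lift (X := total graph)
        (after.fst graph (after graph (total graph)) ≫ T.map (after.snd graph (total graph)))
        (after.snd graph (after graph (total graph)))
        (by rw [Category.assoc, map_bang, after.condition]) ≫ comp)
      (by
        have h : T.μ.app (total graph) ≫ T.map (bang (total graph)) =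
          T.map (T.map (bang (total graph))) ≫ T.μ.app (one S) :=
          (T.μ.naturality (bang (total graph))).symm
        simp only [Category.assoc]
        rw [comp_dom, h, ← Category.assoc (after.lift _ _ _), after.lift_fst]
        simp only [Category.assoc]
        rw [← T.map_comp_assoc, ← T.map_comp_assoc, after.condition]) ≫ comp

namespace Operad

variable {T}

/-- The map of composites of spans induced by a map of graphs. -/
def afterMap {P R : Operad T} (f : P.graph ⟶ R.graph) :
    after P.graph (total P.graph) ⟶ after R.graph (total R.graph) :=
  after.lift (after.fst _ _ ≫ T.map (totalMap f)) (after.snd _ _ ≫ totalMap f) (by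
    have h : totalMap f ≫ dom R.graph = dom P.graph := by
      ext x
      exact ConcreteCategory.congr_hom (Over.w f) x
    rw [Category.assoc, map_bang, Category.assoc, h, after.condition])

theorem afterMap_id (P : Operad T) :
    afterMap (𝟙 P.graph) = 𝟙 (after P.graph (total P.graph)) := by
  refine after.hom_ext ?_ ?_
  · refine (congrArg (fun m => after.fst P.graph (total P.graph) ≫ m)
      (T.map_id (total P.graph))).trans ?_
    rw [Category.comp_id, Category.id_comp]
  · rfl

theorem afterMap_comp {P R U : Operad T} (f : P.graph ⟶ R.graph) (g : R.graph ⟶ U.graph) :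
    afterMap (f ≫ g) = afterMap f ≫ afterMap g := by
  refine after.hom_ext ?_ ?_
  · exact congrArg (fun m => after.fst P.graph (total P.graph) ≫ m)
      (T.map_comp (totalMap f) (totalMap g))
  · rfl

/-- Morphisms of operads. -/
@[ext]
structure Hom (P R : Operad T) where
  map : P.graph ⟶ R.graph
  map_ids : P.ids ≫ totalMap map = R.ids
  map_comp : P.comp ≫ totalMap map = afterMap map ≫ R.comp

instance : Category (Operad T) where
  Hom := Hom
  id P := ⟨𝟙 _, rfl, by
    rw [afterMap_id]; rfl⟩
  comp f g := ⟨f.map ≫ g.map, by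
    rw [← g.map_ids, ← f.map_ids]; rfl, by
    rw [afterMap_comp, Category.assoc, ← g.map_comp, ← Category.assoc (afterMap f.map),
      ← f.map_comp, Category.assoc]; rfl⟩
  id_comp f := Hom.ext (Category.id_comp _)
  comp_id f := Hom.ext (Category.comp_id _)
  assoc f g h := Hom.ext (Category.assoc _ _ _)

variable (T)

/-- The functor that sends an operad to its underlying graph. -/
def forget : Operad T ⥤ Over (T1 T).left where
  obj P := P.graph
  map f := f.map

end Operad

open Classical in
/-- The free operad monad `T'`, on the category of graphs `T 1 ← A → 1` in `Set/S`, which is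
`Set/S'` for the underlying set `S'` of `T 1`.  It is the monad of the adjunction between the
forgetful functor of operads and its left adjoint (with an arbitrary value if there is none). -/
noncomputable def freeOperadMonad : Monad (Over (T1 T).left) :=
  if _h : (Operad.forget T).IsRightAdjoint then
    (Adjunction.ofIsRightAdjoint (Operad.forget T)).toMonad
  else Monad.id _

end SetMonad

/-- A monad on a category of the form `Set/S`. -/
structure SetSliceMonad where
  S : Type
  T : Monad (Over S)

/-- The monads `(Set/S_k, T_k)`: `(Set/S_0, T_0) = (Set/1, id)`, which is `(Set, id)`, and
`(Set/S_{k+1}, T_{k+1})` is the free operad monad `(Set/S_k, T_k)'`. -/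
noncomputable def leinsterMonad : ℕ → SetSliceMonad
  | 0 => ⟨Unit, Monad.id _⟩
  | k + 1 => ⟨(SetMonad.T1 (leinsterMonad k).T).left, SetMonad.freeOperadMonad (leinsterMonad k).T⟩

/-- The iterated slice `Q^{k+}`. -/
def iteratedSlice (Q : SymMulticat) : ℕ → SymMulticat
  | 0 => Q
  | k + 1 => (iteratedSlice Q k).slice

/-- The category `o(I^{k+})` of Baez-Dolan `k`-opetopes. -/
abbrev BaezDolanOpetope (k : ℕ) : Type := (iteratedSlice SymMulticat.unit k).Obj

/-- The set `S_k` of Leinster `k`-opetopes. -/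
abbrev LeinsterOpetope (k : ℕ) : Type := (leinsterMonad k).S

/-! The proof is an induction on k for a stronger invariant, `Model Q T`, which says that the
symmetric multicategory Q presents the monad T on Set/S. On objects, o(Q) is equivalent to the
discrete category S. On arrows, T is familially represented by Q: an arrow f with source x gives a
generic element `gen f` of T applied to the classes of x; every element of TX is the image of some
generic element; a map out of the source of f is determined by the image of `gen f`; and generic
elements with the same image in T1 differ by a bijection of sources. Since `gen` respects
composition, the unit and multiplication of T are cartesian (`exists_tpure`, `tpure_injective`,
`exists_tbind`, `tbind_injective`).

This passes to the slice. Between two arrows of Q there is at most one morphism in elt(Q), and there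
is one exactly when the arrows have the same class in T1 (`arrowHom_subsingleton`,
`cl_eq_of_arrowHom`, `exists_arrowHom`). Every element of T1 is a class, so elt(Q) is equivalent to
the discrete category on T1.

The free operad on a graph X consists of trees with nodes labelled in X. By cartesianness, a tree
with leaves labelled in Y amounts to its shape together with a compatible element of TY
(`exists_leaves`, `tree_ext`). A composable pair is therefore a tree of trees, and composition is
grafting. Evaluation of trees in an arbitrary operad (`interp`, `interp_graft`) gives the universal
property (`forget_isRightAdjoint`).

Finally, an arrow of the slice is a tree with bijectively labelled nodes, hence an element of the
free operad on the classes of its nodes; its leaves and its value are forced by the target arrow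
(`lv_tree`, `config_of_tree`). A tree can be read off from its composite in a free operad, up to the
names of nodes and leaves (`IsFreeOn`), so these elements are generic. Thus `Model.slice` presents
the free operad monad by the slice of Q. -/

namespace SetMonad

/-! ### Elementwise calculus for a monad on Set/S -/

variable {S : Type}

/-- The map to `S` of a set over `S`. -/
abbrev col (X : Over S) : X.left → S := fun a => X.hom a

/-- A family of elements of `S`, regarded as a set over `S`. -/
abbrev fam {ι : Type} (x : ι → S) : Over S := Over.mk (TypeCat.ofHom x)

/-- The morphism of `Set/S` given by a function over `S`. -/
abbrev mkHom {X Y : Over S} (h : X.left → Y.left) (w : ∀ a, col Y (h a) = col X a) : X ⟶ Y :=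
  Over.homMk (TypeCat.ofHom h) (by ext a; exact w a)

theorem over_hom_ext {X Y : Over S} {f g : X ⟶ Y} (h : ∀ a, f.left a = g.left a) : f = g := by
  ext a
  exact h a

theorem col_left {X Y : Over S} (f : X ⟶ Y) (a : X.left) : col Y (f.left a) = col X a :=
  ConcreteCategory.congr_hom (Over.w f) a

variable (T : Monad (Over S))

/-- The action of `T` on maps, in terms of elements. -/
def tmap {X Y : Over S} (f : X ⟶ Y) (q : (T.obj X).left) : (T.obj Y).left := (T.map f).left q

/-- The unit of `T`, in terms of elements. -/
def tpure (X : Over S) (a : X.left) : (T.obj X).left := (T.η.app X).left a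

/-- The Kleisli extension for `T`, in terms of elements. -/
def tbind {X Y : Over S} (k : X ⟶ T.obj Y) (q : (T.obj X).left) : (T.obj Y).left :=
  (T.μ.app Y).left ((T.map k).left q)

variable {T}

theorem col_tmap {X Y : Over S} (f : X ⟶ Y) (q : (T.obj X).left) :
    col _ (tmap T f q) = col _ q := col_left (T.map f) q

theorem col_tpure {X : Over S} (a : X.left) : col _ (tpure T X a) = col X a :=
  col_left (T.η.app X) a

theorem left_congr {X Y : Over S} {f g : X ⟶ Y} (h : f = g) (a : X.left) :
    f.left a = g.left a := by rw [h]

theorem tmap_id {X : Over S} (q : (T.obj X).left) : tmap T (𝟙 X) q = q :=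
  left_congr (T.map_id X) q

theorem tmap_tmap {X Y Z : Over S} (f : X ⟶ Y) (g : Y ⟶ Z) (q : (T.obj X).left) :
    tmap T g (tmap T f q) = tmap T (f ≫ g) q :=
  (left_congr (T.map_comp f g) q).symm

theorem tmap_congr {X Y : Over S} {f g : X ⟶ Y} (h : ∀ a, f.left a = g.left a)
    (q : (T.obj X).left) : tmap T f q = tmap T g q := by rw [over_hom_ext h]

theorem tmap_of_id {X : Over S} {f : X ⟶ X} (h : ∀ a, f.left a = a)
    (q : (T.obj X).left) : tmap T f q = q :=
  (tmap_congr (g := 𝟙 X) h q).trans (tmap_id q)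

theorem tbind_congr {X Y : Over S} {k k' : X ⟶ T.obj Y} (h : ∀ a, k.left a = k'.left a)
    (q : (T.obj X).left) : tbind T k q = tbind T k' q := by rw [over_hom_ext h]

theorem tmap_tpure {X Y : Over S} (f : X ⟶ Y) (a : X.left) :
    tmap T f (tpure T X a) = tpure T Y (f.left a) :=
  (left_congr (T.η.naturality f) a).symm

theorem tbind_tpure {X Y : Over S} (k : X ⟶ T.obj Y) (a : X.left) :
    tbind T k (tpure T X a) = k.left a := by
  refine (congrArg (T.μ.app Y).left (tmap_tpure k a)).trans ?_
  exact left_congr (T.left_unit Y) (k.left a)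

theorem tbind_tmap {X Y Z : Over S} (f : X ⟶ Y) (k : Y ⟶ T.obj Z) (q : (T.obj X).left) :
    tbind T k (tmap T f q) = tbind T (f ≫ k) q :=
  congrArg (T.μ.app Z).left (tmap_tmap f k q)

theorem tmap_tbind {X Y Z : Over S} (k : X ⟶ T.obj Y) (f : Y ⟶ Z) (q : (T.obj X).left) :
    tmap T f (tbind T k q) = tbind T (k ≫ T.map f) q := by
  refine (left_congr (T.μ.naturality f) ((T.map k).left q)).symm.trans ?_
  exact congrArg (T.μ.app Z).left (tmap_tmap k (T.map f) q)

theorem tbind_tbind {X Y Z : Over S} (k : X ⟶ T.obj Y) (k' : Y ⟶ T.obj Z)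
    (q : (T.obj X).left) :
    tbind T k' (tbind T k q) = tbind T (k ≫ T.map k' ≫ T.μ.app Z) q := by
  have h1 : tmap T k' (tbind T k q) = tbind T (k ≫ T.map k') q := tmap_tbind k k' q
  refine (congrArg (T.μ.app Z).left h1).trans ?_
  refine (left_congr (T.assoc Z) ((T.map (k ≫ T.map k')).left q)).symm.trans ?_
  refine congrArg (T.μ.app Z).left ?_
  refine (tmap_tmap (k ≫ T.map k') (T.μ.app Z) q).trans ?_
  rw [Category.assoc]; rfl

theorem tbind_pure_right {X Y : Over S} (f : X ⟶ Y) (q : (T.obj X).left) :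
    tbind T (f ≫ T.η.app Y) q = tmap T f q := by
  rw [← tbind_tmap]
  exact left_congr (T.right_unit Y) (tmap T f q)

theorem tmap_bang_tmap {X Y : Over S} (f : X ⟶ Y) (q : (T.obj X).left) :
    tmap T (bang Y) (tmap T f q) = tmap T (bang X) q := by
  rw [tmap_tmap, hom_bang]

end SetMonad

/-! ### Monads presented by a symmetric multicategory -/

open SetMonad

/-- A description of the monad `T` by means of the symmetric multicategory `Q`: the category of
objects of `Q` is equivalent to the discrete category `S`, and an arrow of `Q` with source
`x` determines an element `gen f` of `T` applied to `x`, through which every element of a value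
of `T` factors in an essentially unique way. -/
structure Model (Q : SymMulticat) {S : Type} (T : Monad (Over S)) where
  cls : Q.Obj → S
  thin : ∀ {x y : Q.Obj} (a b : x ⟶ y), a = b
  cls_eq : ∀ {x y : Q.Obj}, (x ⟶ y) → cls x = cls y
  exists_hom : ∀ {x y : Q.Obj}, cls x = cls y → Nonempty (x ⟶ y)
  cls_surj : Function.Surjective cls
  gen : ∀ {ι : Type} {x : ι → Q.Obj} {y : Q.Obj}, Q.Hom x y →
    (T.obj (fam fun i => cls (x i))).left
  col_gen : ∀ {ι : Type} {x : ι → Q.Obj} {y : Q.Obj} (f : Q.Hom x y), col _ (gen f) = cls y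
  gen_perm : ∀ {ι κ : Type} (e : ι ≃ κ) {x : ι → Q.Obj} {x' : κ → Q.Obj} {y : Q.Obj}
    (f : Q.Hom x y) (h : ∀ i, x i = x' (e i)),
    gen (Q.perm e f h) = tmap T (mkHom (X := fam fun i => cls (x i))
      (Y := fam fun i => cls (x' i)) e (fun i => congrArg cls (h i).symm)) (gen f)
  gen_incl : ∀ {x y : Q.Obj} (a : x ⟶ y),
    gen (Q.incl a) = tpure T (fam fun _ : Unit => cls x) ()
  gen_comp : ∀ {ι : Type} {κ : ι → Type} {x : ι → Q.Obj} {y : Q.Obj} {w : ∀ i, κ i → Q.Obj}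
    (f : Q.Hom x y) (g : ∀ i, Q.Hom (w i) (x i)),
    gen (Q.comp f g) = tbind T (mkHom (X := fam fun i => cls (x i))
      (Y := T.obj (fam fun p : Σ i, κ i => cls (w p.1 p.2)))
      (fun i => tmap T (mkHom (X := fam fun j => cls (w i j)) (fun j => (⟨i, j⟩ : Σ i, κ i))
        (fun _ => rfl)) (gen (g i)))
      (fun i => (col_tmap _ _).trans (col_gen (g i)))) (gen f)
  lift_unique : ∀ {ι : Type} {x : ι → Q.Obj} {y : Q.Obj} (f : Q.Hom x y) {X : Over S}
    (h h' : (fam fun i => cls (x i)) ⟶ X), tmap T h (gen f) = tmap T h' (gen f) → h = h'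
  -- Uniqueness of the bijection is not demanded here because it follows from `lift_unique`.
  exists_equiv : ∀ {ι ι' : Type} {x : ι → Q.Obj} {x' : ι' → Q.Obj} {y y' : Q.Obj}
    (f : Q.Hom x y) (f' : Q.Hom x' y'),
    tmap T (bang _) (gen f) = tmap T (bang _) (gen f') →
    ∃ (e : ι ≃ ι') (he : ∀ i, cls (x' (e i)) = cls (x i)),
      tmap T (mkHom (X := fam fun i => cls (x i)) (Y := fam fun i => cls (x' i)) e he) (gen f) =
        gen f'
  faithful : ∀ {ι : Type} {x : ι → Q.Obj} {y : Q.Obj} (f f' : Q.Hom x y), gen f = gen f' → f = f'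
  exists_gen : ∀ {X : Over S} (q : (T.obj X).left),
    ∃ (ι : Type) (x : ι → Q.Obj) (y : Q.Obj) (f : Q.Hom x y)
      (h : (fam fun i => cls (x i)) ⟶ X), tmap T h (gen f) = q

namespace Model

variable {Q : SymMulticat} {S : Type} {T : Monad (Over S)} (M : Model Q T)

/-- The set of objects of `S` determined by a family of objects of `Q`. -/
abbrev src {ι : Type} (x : ι → Q.Obj) : Over S := fam fun i => M.cls (x i)

/-- The element of `T 1` determined by an arrow. -/
def cl {ι : Type} {x : ι → Q.Obj} {y : Q.Obj} (f : Q.Hom x y) : (T1 T).left :=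
  tmap T (bang _) (M.gen f)

theorem col_cl {ι : Type} {x : ι → Q.Obj} {y : Q.Obj} (f : Q.Hom x y) :
    col _ (M.cl f) = M.cls y := (col_tmap _ _).trans (M.col_gen f)

/-- The object-morphism between objects of the same class. -/
noncomputable def hom {x y : Q.Obj} (h : M.cls x = M.cls y) : x ⟶ y := (M.exists_hom h).some

/-- Object-morphisms are invisible to `gen`: `gen (incl b)` is a unit of T, so the left unit law
applies. -/
theorem gen_post {ι : Type} {x : ι → Q.Obj} {y y' : Q.Obj} (b : y ⟶ y') (f : Q.Hom x y) :
    M.gen (Q.post b f) = M.gen f := by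
  unfold SymMulticat.post
  refine (M.gen_perm _ _ _).trans ?_
  rw [M.gen_comp, M.gen_incl, tbind_tpure]
  refine (tmap_tmap _ _ _).trans ?_
  exact tmap_of_id (fun _ => rfl) _

/-- Turns the condition `act_eq` on a morphism of arrows into an equation in T that involves only
the permutation. -/
theorem gen_act {ι κ : Type} (e : ι ≃ κ) {x : ι → Q.Obj} {x' : κ → Q.Obj} {y y' : Q.Obj}
    (a : ∀ i, x' (e i) ⟶ x i) (b : y ⟶ y') (f : Q.Hom x y) :
    M.gen (Q.act e a b f) =
      tmap T (mkHom (X := M.src x) (Y := M.src x') e (fun i => M.cls_eq (a i))) (M.gen f) := by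
  unfold SymMulticat.act
  refine (M.gen_perm _ _ _).trans ?_
  rw [M.gen_post, M.gen_comp]
  refine (tmap_tbind _ _ _).trans ?_
  rw [← tbind_pure_right]
  refine tbind_congr (fun i => ?_) _
  refine (tmap_tmap _ _ _).trans ?_
  rw [M.gen_incl]
  exact tmap_tpure _ _

/-- Elements of the values of `T` lift uniquely along `gen f`. -/
theorem exists_lift {ι : Type} {x : ι → Q.Obj} {y : Q.Obj} (f : Q.Hom x y) {X : Over S}
    (q : (T.obj X).left) (hq : tmap T (bang X) q = M.cl f) :
    ∃ h : M.src x ⟶ X, tmap T h (M.gen f) = q := by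
  -- The arrow that generates q has the same class as f, so its generic element is a reindexing of
  -- `gen f`.
  obtain ⟨ι', x', y', f', h', rfl⟩ := M.exists_gen q
  rw [tmap_bang_tmap] at hq
  obtain ⟨e, he, H⟩ := M.exists_equiv f f' hq.symm
  exact ⟨_, by rw [← tmap_tmap, H]⟩

/-- The target can be prescribed within its class, since postcomposing with an object-morphism
leaves `gen` unchanged. This is what makes chosen representatives composable. -/
theorem exists_arr (p : (T1 T).left) (y : Q.Obj) (hy : M.cls y = col _ p) :
    ∃ (ι : Type) (x : ι → Q.Obj) (f : Q.Hom x y), M.cl f = p := by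
  obtain ⟨ι, x, y', f, h, rfl⟩ := M.exists_gen p
  have hy' : M.cls y' = M.cls y := by rw [hy, col_tmap, M.col_gen]
  refine ⟨ι, x, Q.post (M.hom hy') f, ?_⟩
  unfold cl
  rw [gen_post]
  exact tmap_congr (fun a => (col_left h a).symm) _

theorem exists_arrow (p : (T1 T).left) : ∃ A : Q.Arrow, M.cl A.arr = p := by
  obtain ⟨y, hy⟩ := M.cls_surj (col _ p)
  obtain ⟨ι, x, f, hf⟩ := M.exists_arr p y hy
  have := Q.finite_source f
  obtain ⟨n, ⟨e⟩⟩ := Finite.exists_equiv_fin ι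
  refine ⟨⟨n, fun i => x (e.symm i), y, Q.perm e f (fun i => by simp)⟩, ?_⟩
  unfold cl
  rw [M.gen_perm, tmap_bang_tmap]
  exact hf

/-- The permutation is forced by `lift_unique`, and the object-morphisms by thinness of o(Q). -/
theorem arrowHom_subsingleton (M : Model Q T) {A B : Q.Arrow} (α β : A ⟶ B) : α = β := by
  have h : α.perm = β.perm := by
    have h1 := (congrArg M.gen α.act_eq).trans (congrArg M.gen β.act_eq).symm
    rw [gen_act, gen_act] at h1
    ext i : 1
    exact left_congr (M.lift_unique _ _ _ h1) i
  obtain ⟨p, s, t, _⟩ := α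
  obtain ⟨p', s', t', _⟩ := β
  obtain rfl : p = p' := h
  obtain rfl : s = s' := funext fun _ => M.thin _ _
  obtain rfl : t = t' := M.thin _ _
  rfl

theorem cl_eq_of_arrowHom {A B : Q.Arrow} (α : A ⟶ B) : M.cl A.arr = M.cl B.arr := by
  unfold cl
  rw [← α.act_eq, gen_act, tmap_bang_tmap]

/-- `exists_equiv` supplies the permutation, equality of classes the object-morphisms, and
`faithful` shows that they carry one arrow to the other. -/
theorem exists_arrowHom {A B : Q.Arrow} (h : M.cl A.arr = M.cl B.arr) : Nonempty (A ⟶ B) := by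
  obtain ⟨e, he, H⟩ := M.exists_equiv _ _ h
  refine ⟨⟨e, fun i => M.hom (he i), M.hom ?_, ?_⟩⟩
  · rw [← M.col_cl A.arr, h, M.col_cl]
  · apply M.faithful
    rw [gen_act]
    exact H

/-- The multiplication of `T` is cartesian: uniqueness. -/
theorem tbind_injective {ι : Type} {x : ι → Q.Obj} {y : Q.Obj} (f : Q.Hom x y) {X : Over S}
    (k k' : M.src x ⟶ T.obj X)
    (hk : ∀ i, tmap T (bang X) (k.left i) = tmap T (bang X) (k'.left i))
    (h : tbind T k (M.gen f) = tbind T k' (M.gen f)) : k = k' := by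
  have h1 : ∀ i, ∃ (κ : Type) (w : κ → Q.Obj) (g : Q.Hom w (x i)),
      M.cl g = tmap T (bang X) (k.left i) := fun i =>
    M.exists_arr _ (x i) (((col_tmap _ _).trans (col_left k i)).symm)
  choose κ w g hg using h1
  choose l hl using fun i => M.exists_lift (g i) (k.left i) (hg i).symm
  choose l' hl' using fun i => M.exists_lift (g i) (k'.left i) ((hk i).symm.trans (hg i).symm)
  -- With each `k i` written as the image of `gen (g i)` under `l i`, the multiplied element is the
  -- image of the generic element of the composite of f with the `g i` under the joint map l.
  -- Uniqueness of lifts along that composite then applies.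
  have key : ∀ (k : M.src x ⟶ T.obj X) (l : ∀ i, M.src (w i) ⟶ X),
      (∀ i, tmap T (l i) (M.gen (g i)) = k.left i) →
      tbind T k (M.gen f) = tmap T (mkHom (X := M.src fun p : Σ i, κ i => w p.1 p.2)
        (fun p => (l p.1).left p.2) (fun p => col_left (l p.1) p.2)) (M.gen (Q.comp f g)) := by
    intro k l hl
    rw [M.gen_comp, tmap_tbind]
    refine tbind_congr (fun i => ?_) _
    refine (hl i).symm.trans ?_
    exact (tmap_tmap (mkHom (X := M.src (w i)) (Y := M.src fun p : Σ i, κ i => w p.1 p.2)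
      (fun j => ⟨i, j⟩) (fun _ => rfl)) (mkHom (X := M.src fun p : Σ i, κ i => w p.1 p.2)
        (fun p => (l p.1).left p.2) (fun p => col_left (l p.1) p.2)) (M.gen (g i))).symm
  rw [key k l hl, key k' l' hl'] at h
  have h2 := M.lift_unique _ _ _ h
  refine over_hom_ext fun i => ?_
  rw [← hl, ← hl']
  exact tmap_congr (fun j => left_congr h2 ⟨i, j⟩) _

/-- The multiplication of `T` is cartesian: existence. -/
theorem exists_tbind {ι : Type} {x : ι → Q.Obj} {y : Q.Obj} (f : Q.Hom x y) {X : Over S}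
    (k : M.src x ⟶ T1 T) (q : (T.obj X).left)
    (hq : tmap T (bang X) q = tbind T k (M.gen f)) :
    ∃ k' : M.src x ⟶ T.obj X, tbind T k' (M.gen f) = q ∧
      ∀ i, tmap T (bang X) (k'.left i) = k.left i := by
  -- Arrows representing the `k i` compose with f to an arrow of the class below q. Restricting the
  -- lift of q along this composite to the source of each `g i` gives k'.
  choose κ w g hg using fun i => M.exists_arr (k.left i) (x i) (col_left k i).symm
  have h1 : tbind T k (M.gen f) = M.cl (Q.comp f g) := by
    unfold cl
    rw [M.gen_comp, tmap_tbind]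
    refine tbind_congr (fun i => ?_) _
    refine (hg i).symm.trans ?_
    exact (tmap_bang_tmap _ _).symm
  obtain ⟨h, hh⟩ := M.exists_lift _ q (hq.trans h1)
  rw [M.gen_comp, tmap_tbind] at hh
  refine ⟨_, hh, fun i => ?_⟩
  refine (tmap_bang_tmap _ _).trans ((tmap_bang_tmap _ _).trans (hg i))

/-- Elements of the values of `T` that lie over a unit are units. -/
theorem exists_tpure (M : Model Q T) {X : Over S} (q : (T.obj X).left) (s : S)
    (hq : tmap T (bang X) q = tpure T (one S) s) : ∃ a, q = tpure T X a ∧ col X a = s := by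
  obtain ⟨y, rfl⟩ := M.cls_surj s
  have : tmap T (bang X) q = M.cl (Q.incl (𝟙 y)) := by
    rw [hq, cl, M.gen_incl, tmap_tpure]
    rfl
  obtain ⟨h, rfl⟩ := M.exists_lift _ q this
  rw [M.gen_incl, tmap_tpure]
  exact ⟨_, rfl, col_left h _⟩

/-- The generic element of an identity arrow is a unit, so a and b are two maps out of a one-point
source with the same image. -/
theorem tpure_injective (M : Model Q T) {X : Over S} (a b : X.left) (h : tpure T X a = tpure T X b) : a = b := by
  have hc : col X a = col X b := by rw [← col_tpure (T := T) a, h, col_tpure]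
  obtain ⟨y, hy⟩ := M.cls_surj (col X a)
  have h1 := M.lift_unique (Q.incl (𝟙 y)) (X := X) (mkHom (fun _ => a) (fun _ => hy.symm))
    (mkHom (fun _ => b) (fun _ => hc.symm.trans hy.symm)) (by
      rw [M.gen_incl, tmap_tpure, tmap_tpure]; exact h)
  exact left_congr h1 ()

end Model

/-! ### The element of T carried by the leaves of a tree -/

namespace Model

open SymMulticat SymMulticat.Tree

variable {Q : SymMulticat} {S : Type} {T : Monad (Over S)} (M : Model Q T)

section Leaves

variable {N N' L L' : Type} {A : N → Q.Arrow} {z : L → Q.Obj} {z' : L' → Q.Obj}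

/-- The element of `T L` determined by a tree with leaves labelled in `L`. -/
def lv {y : Q.Obj} (t : Tree A z y) : (T.obj (M.src z)).left :=
  tmap T (mkHom (X := M.src fun l : t.Leaves => z (t.leafIdx l)) t.leafIdx (fun _ => rfl))
    (M.gen t.eval)

theorem col_lv {y : Q.Obj} (t : Tree A z y) : col _ (M.lv t) = M.cls y :=
  (col_tmap _ _).trans (M.col_gen _)

theorem lv_edge (l : L) {y : Q.Obj} (a : z l ⟶ y) :
    M.lv (edge (A := A) l a) = tpure T (M.src z) l := by
  refine (congrArg (tmap T _) (M.gen_incl a)).trans ?_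
  exact tmap_tpure _ _

theorem lv_node (n : N) {y : Q.Obj} (a : (A n).tgt ⟶ y)
    (ts : ∀ i : Fin (A n).arity, Tree A z ((A n).src i)) :
    M.lv (node n a ts) = tbind T (mkHom (X := M.src (A n).src) (Y := T.obj (M.src z))
      (fun i => M.lv (ts i)) (fun i => M.col_lv (ts i))) (M.gen (A n).arr) := by
  have h : M.gen (node n a ts).eval = _ := (M.gen_post _ _).trans (M.gen_comp _ _)
  refine (congrArg (tmap T _) h).trans ?_
  refine (tmap_tbind _ _ _).trans ?_
  refine tbind_congr (fun i => ?_) _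
  exact tmap_tmap _ _ _

theorem lv_rootComp {y y' : Q.Obj} (b : y ⟶ y') (t : Tree A z y) :
    M.lv (t.rootComp b) = M.lv t := by
  cases t with
  | edge l a => exact (M.lv_edge _ _).trans (M.lv_edge _ _).symm
  | node n a ts => exact (M.lv_node _ _ _).trans (M.lv_node _ _ _).symm

/-- Grafting is Kleisli extension on leaves: the unit law treats an edge, and associativity of T a
node. -/
theorem lv_graft (φ : N' → N) (u : ∀ l, Tree A z (z' l)) {y : Q.Obj}
    (t : Tree (fun n => A (φ n)) z' y) :
    M.lv (graft φ u t) = tbind T (mkHom (X := M.src z') (Y := T.obj (M.src z))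
      (fun l => M.lv (u l)) (fun l => M.col_lv (u l))) (M.lv t) := by
  induction t with
  | edge l a =>
    rw [lv_edge, tbind_tpure]
    exact M.lv_rootComp _ _
  | node n a ts ih =>
    rw [lv_node, tbind_tbind]
    refine (M.lv_node (A := A) (φ n) a _).trans ?_
    exact tbind_congr ih _

theorem lv_relabel (φ : N' → N) {y : Q.Obj} (t : Tree (fun n => A (φ n)) z y) :
    M.lv (relabel φ t) = M.lv t := by
  induction t with
  | edge l a => exact (M.lv_edge _ _).trans (M.lv_edge _ _).symm
  | node n a ts ih =>
    refine (M.lv_node (A := A) (φ n) a _).trans (Eq.trans ?_ (M.lv_node _ _ _).symm)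
    exact tbind_congr ih _

/-- The element of `T 1` determined by a tree. -/
def dm {y : Q.Obj} (t : Tree A z y) : (T1 T).left := tmap T (bang _) (M.lv t)

theorem col_dm {y : Q.Obj} (t : Tree A z y) : col _ (M.dm t) = M.cls y :=
  (col_tmap _ _).trans (M.col_lv _)

theorem dm_edge (l : L) {y : Q.Obj} (a : z l ⟶ y) :
    M.dm (edge (A := A) l a) = tpure T (one S) (M.cls y) := by
  unfold dm
  rw [lv_edge, tmap_tpure]
  exact congrArg _ (M.cls_eq a)

theorem dm_node (n : N) {y : Q.Obj} (a : (A n).tgt ⟶ y)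
    (ts : ∀ i : Fin (A n).arity, Tree A z ((A n).src i)) :
    M.dm (node n a ts) = tbind T (mkHom (X := M.src (A n).src) (Y := T1 T)
      (fun i => M.dm (ts i)) (fun i => M.col_dm (ts i))) (M.gen (A n).arr) := by
  unfold dm
  rw [lv_node, tmap_tbind]
  exact tbind_congr (fun i => rfl) _

/-- This is `eval_eq` seen through `gen`. The leaf data of a configuration depend on its target
alone, so configurations with the same target can differ only in shape. -/
theorem lv_tree {B : Q.Arrow} (c : Config A B) : M.lv c.tree = M.gen B.arr := by
  rw [← c.eval_eq]
  exact (M.gen_perm (Equiv.ofBijective _ c.leaves) (x' := B.src) c.tree.eval (fun _ => rfl)).symm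

theorem cl_eq_dm {B : Q.Arrow} (c : Config A B) : M.cl B.arr = M.dm c.tree := by
  unfold dm
  rw [lv_tree]
  rfl

end Leaves

end Model

/-! ### Operads in terms of elements -/

namespace SetMonad.Operad

variable {S : Type} {T : Monad (Over S)} (R : Operad T)

/-- The composition of an operad, in terms of elements. -/
def op (q : (T.obj (total R.graph)).left) (a : R.graph.left)
    (h : tmap T (bang _) q = R.graph.hom a) : R.graph.left :=
  R.comp.left ⟨(q, a), h⟩

/-- The identities of an operad, in terms of elements. -/
def unit (s : S) : R.graph.left := R.ids.left s

variable {R}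

theorem op_congr {q q' : (T.obj (total R.graph)).left} {a a' : R.graph.left} (hq : q = q')
    (ha : a = a') (h : tmap T (bang _) q = R.graph.hom a) :
    R.op q a h = R.op q' a' (hq ▸ ha ▸ h) := by
  subst hq ha; rfl

theorem col_op (q a h) : col (total R.graph) (R.op q a h) = col (total R.graph) a :=
  col_left R.comp _

theorem hom_op (q a h) : R.graph.hom (R.op q a h) = tbind T (dom R.graph) q :=
  left_congr R.comp_dom ⟨(q, a), h⟩

theorem col_unit (s : S) : col (total R.graph) (R.unit s) = s := col_left R.ids s

theorem hom_unit (s : S) : R.graph.hom (R.unit s) = tpure T (one S) s :=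
  left_congr R.ids_dom s

theorem col_eq_hom (a : R.graph.left) :
    col (total R.graph) a = col (T1 T) (R.graph.hom a) := rfl

theorem op_pure (a : R.graph.left) (s : S) (h) : R.op (tpure T (total R.graph) a) (R.unit s) h = a := by
  -- Composability forces s to be the colour of a.
  have hs : s = col (total R.graph) a := by
    have h1 := congrArg (col _) h
    rw [col_tmap, col_tpure, hom_unit, col_tpure] at h1
    exact h1.symm
  subst hs
  exact left_congr R.ids_comp a

/-- A family of units factors through the terminal object, so its image in T depends only on the
class of q, which composability identifies with the domain of a. -/
theorem op_unit (a : R.graph.left) {X : Over S} (q : (T.obj X).left) (f : X ⟶ total R.graph)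
    (hf : ∀ x, f.left x = R.unit (col X x)) (h : tmap T (bang _) (tmap T f q) = R.graph.hom a) :
    R.op (tmap T f q) a h = a := by
  have hf' : f = bang X ≫ R.ids := over_hom_ext hf
  have hq : tmap T f q = tmap T R.ids (R.graph.hom a) := by
    rw [← h, tmap_bang_tmap, tmap_tmap, hf']
  rw [op_congr hq rfl]
  exact left_congr R.comp_ids a

/-- The associativity law with its data indexed by an arbitrary Y: b is the middle layer, k the
inputs above it, and c the composites of the two. Taking for Y the source of the lowest node allows
inductions over trees. -/
theorem op_op {Y : Over S} (q : (T.obj Y).left) (a : R.graph.left)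
    (k : Y ⟶ T.obj (total R.graph)) (b : Y ⟶ total R.graph)
    (h : ∀ y, tmap T (bang _) (k.left y) = R.graph.hom (b.left y))
    (c : Y ⟶ total R.graph) (hc : ∀ y, c.left y = R.op (k.left y) (b.left y) (h y))
    (h1 : tmap T (bang _) (tmap T c q) = R.graph.hom a)
    (h2 : tmap T (bang _) (tmap T b q) = R.graph.hom a)
    (h3 : tmap T (bang _) (tbind T k q) = R.graph.hom (R.op (tmap T b q) a h2)) :
    R.op (tmap T c q) a h1 = R.op (tbind T k q) (R.op (tmap T b q) a h2) h3 := by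
  have hkb : k ≫ T.map (bang _) = b ≫ dom R.graph := over_hom_ext h
  let m := after.lift k b hkb
  have hm : tmap T (bang _) (tmap T m q) = R.graph.hom a := by
    rw [tmap_bang_tmap, ← h1, tmap_bang_tmap]
  have key := left_congr R.assoc ⟨(tmap T m q, a), hm⟩
  have hc' : c = m ≫ R.comp := over_hom_ext hc
  have e1 : tmap T c q = tmap T R.comp (tmap T m q) := by rw [tmap_tmap, hc']
  have e2 : tmap T b q = tmap T (after.snd _ _) (tmap T m q) := by
    rw [tmap_tmap]; rfl
  have e3 : tbind T k q = tbind T (after.fst _ _) (tmap T m q) := by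
    rw [tbind_tmap]; rfl
  rw [op_congr e1 rfl, op_congr e3 (op_congr e2 rfl _)]
  exact key

theorem map_hom {R R' : Operad T} (g : R ⟶ R') (a : R.graph.left) :
    R'.graph.hom (g.map.left a) = R.graph.hom a := col_left g.map a

theorem map_unit {R R' : Operad T} (g : R ⟶ R') (s : S) : g.map.left (R.unit s) = R'.unit s :=
  left_congr g.map_ids s

theorem map_op {R R' : Operad T} (g : R ⟶ R') (q a h) (h') :
    g.map.left (R.op q a h) = R'.op (tmap T (totalMap g.map) q) (g.map.left a) h' :=
  left_congr g.map_comp ⟨(q, a), h⟩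

end SetMonad.Operad

/-! ### Evaluation of trees in an operad -/

namespace Model

open SymMulticat SymMulticat.Tree

variable {Q : SymMulticat} {S : Type} {T : Monad (Over S)} (M : Model Q T) (R : Operad T)

/-- A labelling of nodes by elements of an operad, compatible with the labelling by arrows. -/
@[ext]
structure Labelling {N : Type} (A : N → Q.Arrow) where
  val : N → R.graph.left
  hom_val : ∀ n, R.graph.hom (val n) = M.cl (A n).arr

variable {M R}

section

variable {N N' L L' : Type} {A : N → Q.Arrow} {z : L → Q.Obj} {z' : L' → Q.Obj}

theorem Labelling.col_val (r : M.Labelling R A) (n : N) :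
    col (total R.graph) (r.val n) = M.cls (A n).tgt := by
  rw [Operad.col_eq_hom, r.hom_val, M.col_cl]

/-- The composite, in an operad, of the labels of the nodes of a tree. -/
def interp (r : M.Labelling R A) : {y : Q.Obj} → (t : Tree A z y) →
    {a : (total R.graph).left // col (total R.graph) a = M.cls y}
  | y, edge _ _ => ⟨R.unit (M.cls y), Operad.col_unit _⟩
  | _, node n a ts => ⟨R.op (tmap T (mkHom (X := M.src (A n).src) (Y := total R.graph)
      (fun i => (interp r (ts i)).1) (fun i => (interp r (ts i)).2)) (M.gen (A n).arr)) (r.val n)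
      (by rw [tmap_bang_tmap, r.hom_val]; rfl),
      (Operad.col_op _ _ _).trans ((r.col_val n).trans (M.cls_eq a))⟩

/-- The family of composites of trees. -/
abbrev interpHom (r : M.Labelling R A) (u : ∀ l, Tree A z (z' l)) :
    M.src z' ⟶ total R.graph :=
  mkHom (X := M.src z') (Y := total R.graph) (fun l => (interp r (u l)).1)
    (fun l => (interp r (u l)).2)

theorem hom_interp (r : M.Labelling R A) {y : Q.Obj} (t : Tree A z y) :
    R.graph.hom (interp r t).1 = M.dm t := by
  induction t with
  | edge l a => exact (Operad.hom_unit _).trans (M.dm_edge l a).symm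
  | node n a ts ih =>
    refine (Operad.hom_op _ _ _).trans (Eq.trans ?_ (M.dm_node n a ts).symm)
    rw [tbind_tmap]
    exact tbind_congr ih _

theorem interp_rootComp (r : M.Labelling R A) {y y' : Q.Obj} (b : y ⟶ y') (t : Tree A z y) :
    (interp r (t.rootComp b)).1 = (interp r t).1 := by
  cases t with
  | edge l a => exact congrArg R.unit (M.cls_eq b).symm
  | node n a ts => rfl

/-- Restriction of a labelling. -/
def Labelling.comp (r : M.Labelling R A) (φ : N' → N) : M.Labelling R (fun n => A (φ n)) :=
  ⟨fun n => r.val (φ n), fun n => r.hom_val (φ n)⟩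

theorem interp_graft_aux (r : M.Labelling R A) (φ : N' → N) (u : ∀ l, Tree A z (z' l)) {y : Q.Obj}
    (t : Tree (fun n => A (φ n)) z' y) :
    tmap T (bang _) (tmap T (interpHom r u) (M.lv t)) = R.graph.hom (interp (r.comp φ) t).1 := by
  rw [tmap_bang_tmap, hom_interp]; rfl

/-- Evaluation turns grafting into operadic composition: an edge is the unit law, and a node is
associativity applied at the lowest node. -/
theorem interp_graft (r : M.Labelling R A) (φ : N' → N) (u : ∀ l, Tree A z (z' l)) {y : Q.Obj}
    (t : Tree (fun n => A (φ n)) z' y) :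
    (interp r (graft φ u t)).1 =
      R.op (tmap T (interpHom r u) (M.lv t)) (interp (r.comp φ) t).1
        (interp_graft_aux r φ u t) := by
  induction t with
  | edge l a =>
    refine (interp_rootComp r a (u l)).trans ?_
    have e : tmap T (interpHom r u) (M.lv (edge (A := fun n => A (φ n)) l a)) =
        tpure T (total R.graph) (interp r (u l)).1 := by
      rw [lv_edge, tmap_tpure]; rfl
    rw [Operad.op_congr e rfl]
    exact (Operad.op_pure _ _ _).symm
  | node n a ts ih =>
    have key := Operad.op_op (R := R) (M.gen (A (φ n)).arr) (r.val (φ n))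
      (mkHom (X := M.src (A (φ n)).src) (Y := T.obj (total R.graph))
        (fun i => tmap T (interpHom r u) (M.lv (ts i))) (fun i => (col_tmap _ _).trans (M.col_lv _)))
      (interpHom (r.comp φ) ts)
      (fun i => interp_graft_aux r φ u (ts i))
      (interpHom r fun i => graft φ u (ts i)) ih
      (by rw [tmap_bang_tmap, r.hom_val]; rfl)
      (by rw [tmap_bang_tmap, r.hom_val]; rfl)
      (by
        rw [Operad.hom_op, tmap_tbind, tbind_tmap]
        exact tbind_congr (fun i => interp_graft_aux r φ u (ts i)) _)
    refine Eq.trans key ?_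
    refine Operad.op_congr ?_ rfl _
    rw [lv_node, tmap_tbind]
    exact tbind_congr (fun i => rfl) _

theorem interp_relabel (r : M.Labelling R A) (φ : N' → N) {y : Q.Obj}
    (t : Tree (fun n => A (φ n)) z y) :
    (interp r (relabel φ t)).1 = (interp (r.comp φ) t).1 := by
  induction t with
  | edge l a => rfl
  | node n a ts ih =>
    refine Operad.op_congr ?_ rfl _
    exact tmap_congr ih _

/-- The image of a labelling under a morphism of operads. -/
def Labelling.map {R' : Operad T} (r : M.Labelling R A) (g : R ⟶ R') : M.Labelling R' A :=
  ⟨fun n => g.map.left (r.val n), fun n => (Operad.map_hom g _).trans (r.hom_val n)⟩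

theorem map_interp {R' : Operad T} (r : M.Labelling R A) (g : R ⟶ R') {y : Q.Obj}
    (t : Tree A z y) : g.map.left (interp r t).1 = (interp (r.map g) t).1 := by
  induction t with
  | edge l a => exact Operad.map_unit g _
  | node n a ts ih =>
    have e : tmap T (totalMap g.map) (tmap T (interpHom r ts) (M.gen (A n).arr)) =
        tmap T (interpHom (r.map g) ts) (M.gen (A n).arr) := by
      rw [tmap_tmap]
      exact tmap_congr ih _
    refine (Operad.map_op g _ _ _ ?_).trans (Operad.op_congr e rfl _)
    rw [e, tmap_bang_tmap, Operad.map_hom, r.hom_val]; rfl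

/-- Leaf labels do not matter for the composite. -/
theorem interp_graft_edge (r : M.Labelling R A) (e : L → L') (b : ∀ l, z' (e l) ⟶ z l) {y : Q.Obj}
    (t : Tree A z y) :
    (interp r (graft (A := A) (z := z') id (fun l => edge (e l) (b l)) t)).1 = (interp r t).1 := by
  refine (interp_graft r id _ t).trans ?_
  exact Operad.op_unit _ _ (interpHom r fun l => edge (e l) (b l)) (fun _ => rfl) _

end

section Subst

variable {I : Type} {K : I → Type} {x : I → Q.Arrow} {w : ∀ i, K i → Q.Arrow}

/-- The labelling of nodes by the composites of configurations. -/
def Labelling.subst (r : M.Labelling R (fun p : Σ i, K i => w p.1 p.2))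
    (g : ∀ i, Config (w i) (x i)) : M.Labelling R x :=
  ⟨fun i => (interp (r.comp (Sigma.mk i)) (g i).tree).1, fun i => by
    rw [hom_interp, M.cl_eq_dm (g i)]⟩

/-- Substituting at the lowest node is grafting onto the tree of a configuration, whose leaf data
are `gen (x i).arr` by `lv_tree`; this is exactly the input that the node had before. -/
theorem interp_subst (r : M.Labelling R (fun p : Σ i, K i => w p.1 p.2))
    (g : ∀ i, Config (w i) (x i)) {L : Type} {z : L → Q.Obj} {y : Q.Obj} (t : Tree x z y) :
    (interp r (subst g t)).1 = (interp (r.subst g) t).1 := by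
  induction t with
  | edge l a => rfl
  | node i a ts ih =>
    refine (interp_rootComp r a _).trans ?_
    refine (interp_graft r (Sigma.mk i) _ (g i).tree).trans ?_
    refine Operad.op_congr ?_ rfl _
    rw [lv_tree]
    exact tmap_congr ih _

theorem interp_ofHom {A B : Q.Arrow} (α : A ⟶ B) (r : M.Labelling R (fun _ : Unit => A)) :
    (interp r (Config.ofHom α).tree).1 = r.val () :=
  Operad.op_unit _ _ (interpHom r fun i => edge (α.perm i) (α.srcHom i))
    (fun _ => rfl) _

end Subst

end Model

/-! ### Trees as shapes with leaf data -/

namespace Model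

open SymMulticat SymMulticat.Tree

variable {Q : SymMulticat} {S : Type} {T : Monad (Over S)} (M : Model Q T)

/-- An object of a given class. -/
noncomputable def pt (s : S) : Q.Obj := (M.cls_surj s).choose

theorem cls_pt (s : S) : M.cls (M.pt s) = s := (M.cls_surj s).choose_spec

section

variable {N N' L L' : Type} {A : N → Q.Arrow} {z : L → Q.Obj} {z' : L' → Q.Obj}

theorem edge_congr (M : Model Q T) {l l' : L} {y : Q.Obj} (h : l = l') (a : z l ⟶ y)
    (a' : z l' ⟶ y) : edge (A := A) l a = edge l' a' := by
  subst h
  rw [M.thin a a']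

/-- Forget the labels of the leaves, apart from their classes. -/
noncomputable def bangTree {y : Q.Obj} (t : Tree A z y) : Tree A M.pt y :=
  graft (A := A) id (fun l => edge (M.cls (z l)) (M.hom (M.cls_pt _))) t

theorem bangTree_node (n : N) {y : Q.Obj} (a : (A n).tgt ⟶ y)
    (ts : ∀ i : Fin (A n).arity, Tree A z ((A n).src i)) :
    M.bangTree (node n a ts) = node n a (fun i => M.bangTree (ts i)) := rfl

theorem bangTree_rootComp {y y' : Q.Obj} (b : y ⟶ y') (t : Tree A z y) :
    M.bangTree (t.rootComp b) = (M.bangTree t).rootComp b :=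
  graft_rootComp (A := A) id _ b t

theorem bangTree_graft (u : ∀ l, Tree A z (z' l)) {y : Q.Obj} (t : Tree A z' y) :
    M.bangTree (graft (A := A) id u t) = graft (A := A) id (fun l => M.bangTree (u l)) t :=
  graft_graft (A := A) id id _ u t

theorem bangTree_graft_edge (e : L → L') (b : ∀ l, z' (e l) ⟶ z l) {y : Q.Obj} (t : Tree A z y) :
    M.bangTree (graft (A := A) (z := z') id (fun l => edge (e l) (b l)) t) = M.bangTree t := by
  rw [bangTree_graft]
  exact congrArg (fun u => graft (A := A) id u t)
    (funext fun l => M.edge_congr (M.cls_eq (b l)) _ _)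

theorem bangTree_self {y : Q.Obj} (t : Tree A M.pt y) : M.bangTree t = t := by
  refine Eq.trans ?_ ((graft_edge (A := A) id t).trans (relabel_id t))
  exact congrArg (fun u => graft (A := A) id u t)
    (funext fun l => M.edge_congr (M.cls_pt l) _ _)

theorem dm_graft_edge (e : L → L') (b : ∀ l, z' (e l) ⟶ z l) {y : Q.Obj} (t : Tree A z y) :
    M.dm (graft (A := A) (z := z') id (fun l => edge (e l) (b l)) t) = M.dm t := by
  unfold dm
  rw [lv_graft, tmap_tbind]
  refine Eq.trans ?_ (tbind_pure_right (bang (M.src z)) (M.lv t))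
  refine tbind_congr (fun l => ?_) _
  refine (congrArg (tmap T _) (M.lv_edge _ _)).trans ((tmap_tpure _ _).trans ?_)
  exact congrArg (tpure T (one S)) (M.cls_eq (b l))

theorem dm_bangTree {y : Q.Obj} (t : Tree A z y) : M.dm (M.bangTree t) = M.dm t :=
  M.dm_graft_edge (fun l => M.cls (z l)) _ t

theorem lv_graft_edge (e : L → L') (b : ∀ l, z' (e l) ⟶ z l) {y : Q.Obj} (t : Tree A z y) :
    M.lv (graft (A := A) (z := z') id (fun l => edge (e l) (b l)) t) =
      tmap T (mkHom (X := M.src z) (Y := M.src z') e (fun l => M.cls_eq (b l))) (M.lv t) := by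
  rw [lv_graft, ← tbind_pure_right]
  exact tbind_congr (fun l => M.lv_edge _ _) _

/-- The leaves of a tree can be labelled by a given element of a value of `T`. -/
theorem exists_leaves {Y : Over S} (z' : Y.left → Q.Obj) (hz : ∀ l, col Y l = M.cls (z' l))
    {y : Q.Obj} (t : Tree A z y) (q : (T.obj Y).left) (hq : tmap T (bang Y) q = M.dm t) :
    ∃ t' : Tree A z' y, tmap T (mkHom (X := M.src z') (Y := Y) (fun l => l) hz) (M.lv t') = q ∧
      M.bangTree t' = M.bangTree t := by
  induction t generalizing q with
  | @edge l y a =>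
    -- Over a bare edge, q lies over a unit and hence is a unit.
    obtain ⟨b, rfl, hb⟩ := M.exists_tpure q _ (hq.trans (M.dm_edge l a))
    refine ⟨edge b (M.hom ((hz b).symm.trans hb)), ?_, ?_⟩
    · rw [lv_edge, tmap_tpure]; rfl
    · exact M.edge_congr ((hz b).symm.trans (hb.trans (M.cls_eq a).symm)) _ _
  | node n a ts ih =>
    rw [dm_node] at hq
    -- Cartesianness of the multiplication distributes q over the subtrees.
    obtain ⟨k, rfl, hk⟩ := M.exists_tbind _ _ q hq
    choose t' h1 h2 using fun i => ih i (k.left i) (hk i)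
    refine ⟨node n a t', ?_, ?_⟩
    · rw [lv_node, tmap_tbind]
      exact tbind_congr h1 _
    · exact congrArg (node n a) (funext h2)

theorem node_injective {n n' : N} {y : Q.Obj} {a : (A n).tgt ⟶ y} {a' : (A n').tgt ⟶ y}
    {ts : ∀ i : Fin (A n).arity, Tree A z ((A n).src i)}
    {ts' : ∀ i : Fin (A n').arity, Tree A z ((A n').src i)} (h : node n a ts = node n' a' ts') :
    ∃ e : n = n', e ▸ ts = ts' := by
  cases h
  exact ⟨rfl, rfl⟩

/-- A tree is determined by its shape and its leaves. -/
theorem tree_ext {y : Q.Obj} (t t' : Tree A z y) (h : M.bangTree t = M.bangTree t')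
    (hl : M.lv t = M.lv t') : t = t' := by
  induction t with
  | edge l a =>
    cases t' with
    | edge l' a' =>
      rw [lv_edge, lv_edge] at hl
      exact M.edge_congr (M.tpure_injective (X := M.src z) _ _ hl) _ _
    | node n' a' ts' => cases h
  | node n a ts ih =>
    cases t' with
    | edge l' a' => cases h
    | node n' a' ts' =>
      rw [bangTree_node, bangTree_node] at h
      obtain ⟨rfl, h1⟩ := node_injective h
      have h2 : ∀ i, M.bangTree (ts i) = M.bangTree (ts' i) := fun i => congrFun h1 i
      rw [lv_node, lv_node] at hl
      -- Equal shapes give equal images in T1, the side condition for cancelling the multiplication.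
      have h4 : ∀ i, M.dm (ts i) = M.dm (ts' i) := fun i => by
        rw [← M.dm_bangTree, h2, M.dm_bangTree]
      have h3 := (fun hk => M.tbind_injective _ _ _ hk hl) h4
      obtain rfl : ts = ts' := funext fun i => ih i _ (h2 i) (left_congr h3 i)
      rw [M.thin a a']

end

/-! ### The free operad of trees -/

section Free

variable (X : Over (T1 T).left)

/-- A representing arrow of `Q` for each element of a graph. -/
noncomputable def rep (a : X.left) : Q.Arrow := (M.exists_arrow (X.hom a)).choose

theorem cl_rep (a : X.left) : M.cl (M.rep X a).arr = X.hom a :=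
  (M.exists_arrow (X.hom a)).choose_spec

/-- The elements of the free operad on `X` are trees with nodes labelled in `X`. -/
abbrev FreeEl : Type := Σ s : S, Tree (M.rep X) M.pt (M.pt s)

/-- The graph of the free operad. -/
noncomputable abbrev freeGraph : Over (T1 T).left :=
  Over.mk (TypeCat.ofHom fun t : M.FreeEl X => M.dm t.2)

/-- The family of objects that consists of the targets of the elements of the free operad. -/
noncomputable abbrev freeObj : M.FreeEl X → Q.Obj := fun l => M.pt l.1

/-- The comparison of the two ways of regarding the free operad as a set over `S`. -/
noncomputable abbrev freeIso : M.src (M.freeObj X) ⟶ total (M.freeGraph X) :=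
  mkHom (X := M.src (M.freeObj X)) (Y := total (M.freeGraph X)) (fun l => l)
    (fun l => M.col_dm l.2)

theorem tmap_freeIso_injective {q q' : (T.obj (M.src (M.freeObj X))).left}
    (h : tmap T (M.freeIso X) q = tmap T (M.freeIso X) q') : q = q' := by
  have h1 := congrArg (tmap T (mkHom (X := total (M.freeGraph X)) (Y := M.src (M.freeObj X))
    (fun l => l) (fun l => (M.col_dm l.2).symm))) h
  rw [tmap_tmap, tmap_tmap] at h1
  rwa [tmap_of_id (fun _ => rfl), tmap_of_id (fun _ => rfl)] at h1

variable {X}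

/-- A composable pair (q, t) is a single tree of shape t with elements of the free operad at its
leaves; its composite is defined by grafting these. -/
theorem exists_fill (q : (T.obj (total (M.freeGraph X))).left) (t : M.FreeEl X)
    (h : tmap T (bang _) q = M.dm t.2) :
    ∃ t' : Tree (M.rep X) (M.freeObj X) (M.pt t.1),
      tmap T (M.freeIso X) (M.lv t') = q ∧ M.bangTree t' = t.2 := by
  obtain ⟨t', h1, h2⟩ := M.exists_leaves (M.freeObj X) (fun l : M.FreeEl X => M.col_dm l.2) t.2 q h
  exact ⟨t', h1, h2.trans (M.bangTree_self _)⟩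

/-- Graft the trees that label the leaves of a tree. -/
noncomputable def joinTree {y : Q.Obj} (t : Tree (M.rep X) (M.freeObj X) y) : Tree (M.rep X) M.pt y :=
  graft (A := M.rep X) id (fun l : M.FreeEl X => l.2) t

/-- The composition of the free operad. -/
noncomputable def freeOp (q : (T.obj (total (M.freeGraph X))).left) (t : M.FreeEl X)
    (h : tmap T (bang _) q = M.dm t.2) : M.FreeEl X :=
  ⟨t.1, M.joinTree (M.exists_fill q t h).choose⟩

/-- By `tree_ext` the filling is unique, so a composite may be computed from any convenient one. -/
theorem freeOp_eq (q : (T.obj (total (M.freeGraph X))).left) (t : M.FreeEl X)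
    (h : tmap T (bang _) q = M.dm t.2) (t' : Tree (M.rep X) (M.freeObj X) (M.pt t.1))
    (h1 : tmap T (M.freeIso X) (M.lv t') = q) (h2 : M.bangTree t' = t.2) :
    M.freeOp q t h = ⟨t.1, M.joinTree t'⟩ := by
  obtain ⟨k1, k2⟩ := (M.exists_fill q t h).choose_spec
  have : (M.exists_fill q t h).choose = t' :=
    M.tree_ext _ _ (k2.trans h2.symm) (M.tmap_freeIso_injective X (k1.trans h1.symm))
  unfold freeOp
  rw [this]

theorem freeOp_congr {q q' : (T.obj (total (M.freeGraph X))).left} {t t' : M.FreeEl X}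
    (hq : q = q') (ht : t = t') (h : tmap T (bang _) q = M.dm t.2) :
    M.freeOp q t h = M.freeOp q' t' (hq ▸ ht ▸ h) := by
  subst hq ht; rfl

theorem dm_joinTree {y : Q.Obj} (t : Tree (M.rep X) (M.freeObj X) y) :
    M.dm (M.joinTree t) =
      tbind T (dom (M.freeGraph X)) (tmap T (M.freeIso X) (M.lv t)) := by
  unfold dm joinTree
  rw [lv_graft, tmap_tbind, tbind_tmap]
  exact tbind_congr (fun l => rfl) _

/-- The identities of the free operad. -/
noncomputable def freeUnit (s : S) : M.FreeEl X := ⟨s, edge s (𝟙 _)⟩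

variable (X) in
/-- The identities of the free operad, as a morphism. -/
noncomputable abbrev freeIds : one S ⟶ total (M.freeGraph X) :=
  mkHom (X := one S) (Y := total (M.freeGraph X)) (fun s => M.freeUnit s)
    (fun s => (M.col_dm _).trans (M.cls_pt s))

variable (X) in
/-- The composition of the free operad, as a morphism. -/
noncomputable abbrev freeComp :
    after (M.freeGraph X) (total (M.freeGraph X)) ⟶ total (M.freeGraph X) :=
  mkHom (X := after (M.freeGraph X) (total (M.freeGraph X))) (Y := total (M.freeGraph X))
    (fun p => M.freeOp p.1.1 p.1.2 p.2)
    (fun p => (M.col_dm _).trans (M.col_dm p.1.2.2).symm)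

theorem freeOp_pure (t : M.FreeEl X) (s : S) (hs : s = t.1) (h) :
    M.freeOp (tpure T (total (M.freeGraph X)) t) (M.freeUnit s) h = t := by
  subst hs
  refine (M.freeOp_eq _ (M.freeUnit t.1) h (edge t (𝟙 _)) ?_ ?_).trans ?_
  · exact (congrArg (tmap T _) (M.lv_edge _ _)).trans (tmap_tpure _ _)
  · exact M.edge_congr (M.cls_pt _) _ _
  · exact Sigma.ext rfl (heq_of_eq (rootComp_id _))

/-- The filling of t by q puts a one-edge tree at every leaf, and grafting bare edges changes
nothing. -/
theorem freeOp_unit (q : (T.obj (total (M.freeGraph X))).left) (t : M.FreeEl X)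
    (hq : q = tmap T (M.freeIds X) (M.dm t.2)) (h) : M.freeOp q t h = t := by
  refine (M.freeOp_eq _ _ _ (graft (A := M.rep X) (z := M.freeObj X) id
      (fun s => edge (M.freeUnit s) (𝟙 (M.pt s))) t.2) ?_ ?_).trans ?_
  · refine (congrArg (tmap T _) (M.lv_graft_edge _ _ _)).trans ?_
    rw [tmap_tmap, hq, dm, tmap_tmap]
    refine tmap_congr (fun s => ?_) _
    exact congrArg M.freeUnit (M.cls_pt s).symm
  · exact (M.bangTree_graft_edge _ _ _).trans (M.bangTree_self _)
  · refine Sigma.ext rfl (heq_of_eq ?_)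
    refine (graft_graft (A := M.rep X) id id _ _ t.2).trans ?_
    refine Eq.trans ?_ ((graft_edge (A := M.rep X) id t.2).trans (relabel_id t.2))
    exact congrArg (fun u => graft (A := M.rep X) id u t.2)
      (funext fun l => M.edge_congr rfl _ _)

theorem hom_freeOp (q : (T.obj (total (M.freeGraph X))).left) (t : M.FreeEl X)
    (h : tmap T (bang _) q = M.dm t.2) :
    M.dm (M.freeOp q t h).2 = tbind T (dom (M.freeGraph X)) q := by
  obtain ⟨t', rfl, h2⟩ := M.exists_fill q t h
  rw [M.freeOp_eq _ t h t' rfl h2]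
  exact M.dm_joinTree t'

/-- Both bracketings are grafts of three layers of trees, so associativity reduces to `graft_graft`.
-/
theorem freeOp_freeOp (q : (T.obj (after (M.freeGraph X) (total (M.freeGraph X)))).left)
    (t : M.FreeEl X) (h1) (h2) (h3) :
    M.freeOp (tmap T (M.freeComp X) q) t h1 =
      M.freeOp (tbind T (after.fst (M.freeGraph X) (total (M.freeGraph X))) q)
        (M.freeOp (tmap T (after.snd (M.freeGraph X) (total (M.freeGraph X))) q) t h2) h3 := by
  let z' : (after (M.freeGraph X) (total (M.freeGraph X))).left → Q.Obj :=
    fun p => M.freeObj X p.1.2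
  have hz : ∀ p, col (after (M.freeGraph X) (total (M.freeGraph X))) p = M.cls (z' p) :=
    fun p => M.col_dm p.1.2.2
  -- The bottom layer t' has composable pairs p at its leaves; the trees u p chosen next are the
  -- fillings of these pairs.
  obtain ⟨t', rfl, h5⟩ := M.exists_leaves z' hz t.2 q (by rw [tmap_bang_tmap] at h1; exact h1)
  rw [M.bangTree_self] at h5
  choose u hu1 hu2 using fun p : (after (M.freeGraph X) (total (M.freeGraph X))).left =>
    M.exists_fill p.1.1 p.1.2 p.2
  have hcomp : ∀ p : (after (M.freeGraph X) (total (M.freeGraph X))).left,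
      M.freeOp p.1.1 p.1.2 p.2 = ⟨p.1.2.1, M.joinTree (u p)⟩ := fun p =>
    M.freeOp_eq _ _ _ _ (hu1 p) (hu2 p)
  have e1 := M.freeOp_eq (tmap T (M.freeComp X)
      (tmap T (mkHom (X := M.src z') (fun p => p) hz) (M.lv t'))) t h1
    (graft (A := M.rep X) (z := M.freeObj X) id
      (fun p => edge (M.freeOp p.1.1 p.1.2 p.2) (𝟙 (z' p))) t')
    (by
      refine (congrArg (tmap T _) (M.lv_graft_edge _ _ _)).trans ?_
      rw [tmap_tmap, tmap_tmap]
      exact tmap_congr (fun p => rfl) _)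
    ((M.bangTree_graft_edge _ _ _).trans h5)
  have e2 := M.freeOp_eq (tmap T (after.snd (M.freeGraph X) (total (M.freeGraph X)))
      (tmap T (mkHom (X := M.src z') (fun p => p) hz) (M.lv t'))) t h2
    (graft (A := M.rep X) (z := M.freeObj X) id
      (fun p => edge p.1.2 (𝟙 (z' p))) t')
    (by
      refine (congrArg (tmap T _) (M.lv_graft_edge _ _ _)).trans ?_
      rw [tmap_tmap, tmap_tmap]
      exact tmap_congr (fun p => rfl) _)
    ((M.bangTree_graft_edge _ _ _).trans h5)
  -- Since u p has the shape of the second component of p, the lower two layers joined have the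
  -- shape of t' with u grafted on. That graft is therefore the filling needed for the outer
  -- composite on the right.
  have e2' : M.joinTree (graft (A := M.rep X) (z := M.freeObj X) id
      (fun p => edge p.1.2 (𝟙 (z' p))) t') =
      M.bangTree (graft (A := M.rep X) (z := M.freeObj X) id u t') := by
    refine (graft_graft (A := M.rep X) id id _ _ t').trans ?_
    refine Eq.trans ?_ (M.bangTree_graft _ _).symm
    exact congrArg (fun u => graft (A := M.rep X) id u t')
      (funext fun p => (rootComp_id _).trans (hu2 p).symm)
  have e4 : M.freeOp (tmap T (after.snd (M.freeGraph X) (total (M.freeGraph X)))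
      (tmap T (mkHom (X := M.src z') (fun p => p) hz) (M.lv t'))) t h2 =
      ⟨t.1, M.bangTree (graft (A := M.rep X) (z := M.freeObj X) id u t')⟩ :=
    e2.trans (Sigma.ext rfl (heq_of_eq e2'))
  refine e1.trans (Eq.trans ?_ (freeOp_congr M rfl e4 h3).symm)
  refine Eq.trans ?_ (M.freeOp_eq _ ⟨t.1, M.bangTree (graft (A := M.rep X) (z := M.freeObj X)
    id u t')⟩ _ (graft (A := M.rep X) (z := M.freeObj X) id u t') ?_ rfl).symm
  · refine Sigma.ext rfl (heq_of_eq ?_)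
    refine (graft_graft (A := M.rep X) id id _ _ t').trans ?_
    refine Eq.trans ?_ (graft_graft (A := M.rep X) id id _ _ t').symm
    refine congrArg (fun u => graft (A := M.rep X) id u t') (funext fun p => ?_)
    refine (rootComp_id _).trans ?_
    exact eq_of_heq (Sigma.ext_iff.1 (hcomp p)).2
  · refine (congrArg (tmap T _) (M.lv_graft _ _ _)).trans ?_
    rw [tmap_tbind, tbind_tmap]
    exact tbind_congr hu1 _

variable (X)

/-- The free operad. -/
noncomputable def free : Operad T where
  graph := M.freeGraph X
  ids := M.freeIds X
  ids_dom := over_hom_ext fun s =>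
    (M.dm_edge _ _).trans (congrArg (tpure T (one S)) (M.cls_pt s))
  comp := M.freeComp X
  comp_dom := over_hom_ext fun p => M.hom_freeOp p.1.1 p.1.2 p.2
  ids_comp := over_hom_ext fun t => M.freeOp_pure t _ ((M.col_dm t.2).trans (M.cls_pt t.1))
    (by
      rw [tmap_tpure]
      exact ((M.dm_edge _ _).trans (congrArg (tpure T (one S)) (M.cls_pt _))).symm)
  comp_ids := over_hom_ext fun t => M.freeOp_unit _ t rfl
    (by
      rw [tmap_bang_tmap]
      exact tmap_of_id (fun _ => rfl) _)
  assoc := over_hom_ext fun p => M.freeOp_freeOp p.1.1 p.1.2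
    (by
      rw [tmap_bang_tmap]
      exact p.2)
    (by
      rw [tmap_bang_tmap]
      exact p.2)
    (by
      rw [hom_freeOp, tmap_tbind, tbind_tmap]
      exact tbind_congr
        (fun a : (after (M.freeGraph X) (total (M.freeGraph X))).left => a.2) _)

end Free

end Model

/-! ### The universal property of the free operad -/

namespace Model

open SymMulticat SymMulticat.Tree

variable {Q : SymMulticat} {S : Type} {T : Monad (Over S)} (M : Model Q T)

section

variable {X : Over (T1 T).left}

/-- The target y determines the class of both roots, and the lowest edge label can be undone because
o(Q) is thin and has a morphism back. -/
theorem freeEl_ext (M : Model Q T) {u u' : M.FreeEl X} {y : Q.Obj} (b : M.pt u.1 ⟶ y)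
    (b' : M.pt u'.1 ⟶ y) (h : u.2.rootComp b = u'.2.rootComp b') : u = u' := by
  obtain ⟨s, t⟩ := u
  obtain ⟨s', t'⟩ := u'
  obtain rfl : s = s' := by
    rw [← M.cls_pt s, M.cls_eq b, ← M.cls_eq b', M.cls_pt]
  have h1 := congrArg (rootComp (M.hom (M.cls_eq b).symm)) h
  rw [rootComp_rootComp, rootComp_rootComp, M.thin (b ≫ _) (𝟙 _), M.thin (b' ≫ _) (𝟙 _),
    rootComp_id, rootComp_id] at h1
  exact Sigma.ext rfl (heq_of_eq h1)

theorem rootComp_congr (M : Model Q T) {N L : Type} {A : N → Q.Arrow} {z : L → Q.Obj} {y y' : Q.Obj}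
    (b b' : y ⟶ y') (t : Tree A z y) : t.rootComp b = t.rootComp b' := by
  rw [M.thin b b']

theorem rootComp_self (M : Model Q T) {N L : Type} {A : N → Q.Arrow} {z : L → Q.Obj} {y : Q.Obj}
    (b : y ⟶ y) (t : Tree A z y) : t.rootComp b = t :=
  (M.rootComp_congr _ _ _).trans (rootComp_id t)

variable (X) in
/-- An element of the free operad, given by a tree. -/
noncomputable def ofTree {y : Q.Obj} (t : Tree (M.rep X) M.pt y) : M.FreeEl X :=
  ⟨M.cls y, t.rootComp (M.hom (M.cls_pt _).symm)⟩

theorem ofTree_rootComp {y y' : Q.Obj} (t : Tree (M.rep X) M.pt y) (b : y ⟶ y') :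
    M.ofTree X (t.rootComp b) = M.ofTree X t := by
  refine M.freeEl_ext (M.hom (M.cls_pt _))
    (M.hom ((M.cls_pt _).trans (M.cls_eq b)) : M.pt (M.cls y) ⟶ y') ?_
  exact (rootComp_rootComp _ _ _).trans ((rootComp_rootComp _ _ _).trans
    ((M.rootComp_congr _ _ _).trans (rootComp_rootComp _ _ _).symm))

theorem ofTree_snd (u : M.FreeEl X) : M.ofTree X u.2 = u := by
  refine M.freeEl_ext (M.hom (M.cls_pt _)) (𝟙 _) ?_
  exact (rootComp_rootComp _ _ _).trans (M.rootComp_congr _ _ _)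

theorem dm_rootComp {N L : Type} {A : N → Q.Arrow} {z : L → Q.Obj} {y y' : Q.Obj} (b : y ⟶ y')
    (t : Tree A z y) : M.dm (t.rootComp b) = M.dm t :=
  congrArg (tmap T (bang _)) (M.lv_rootComp b t)

variable (X) in
/-- The tree with one node. -/
noncomputable def corollaTree (a : X.left) : Tree (M.rep X) M.pt (M.rep X a).tgt :=
  node a (𝟙 _) (fun i => edge (M.cls ((M.rep X a).src i)) (M.hom (M.cls_pt _)))

variable (X) in
/-- The generators of the free operad. -/
noncomputable def corolla (a : X.left) : M.FreeEl X := M.ofTree X (M.corollaTree X a)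

theorem dm_corolla (a : X.left) : M.dm (M.corolla X a).2 = X.hom a := by
  refine (M.dm_rootComp _ (M.corollaTree X a)).trans ?_
  refine Eq.trans ?_ (M.cl_rep X a)
  refine (M.dm_node _ _ _).trans ?_
  refine Eq.trans ?_ (tbind_pure_right (bang (M.src (M.rep X a).src)) _)
  exact tbind_congr (fun i => M.dm_edge _ _) _

theorem cls_freeObj {Y : Over S} (k : Y ⟶ total (M.freeGraph X)) (i : Y.left) :
    M.cls (M.freeObj X (k.left i)) = col Y i :=
  Eq.trans (M.col_dm (N := X.left) (Sigma.snd (k.left i))).symm (col_left k i)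

/-- Composing into a corolla adds a lowest node a with the given trees as branches, so a and the
inputs can be read off from the result. -/
theorem freeOp_corolla (a : X.left)
    (k : M.src (M.rep X a).src ⟶ total (M.freeGraph X)) (h) :
    M.freeOp (tmap T k (M.gen (M.rep X a).arr)) (M.corolla X a) h =
      M.ofTree X (node a (𝟙 _) (fun i => (Sigma.snd (k.left i)).rootComp
        (M.hom (M.cls_freeObj k i)))) := by
  refine (M.freeOp_eq _ (M.corolla X a) h ((node (z := M.freeObj X) a (𝟙 _)
    fun i => edge (k.left i) (M.hom (M.cls_freeObj k i))).rootComp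
      (M.hom (M.cls_pt _).symm)) ?_ ?_).trans ?_
  · refine (congrArg (tmap T _) ((M.lv_rootComp _ _).trans (M.lv_node _ _ _))).trans ?_
    refine (tmap_tbind _ _ _).trans ?_
    rw [← tbind_pure_right]
    refine tbind_congr (fun i => ?_) _
    exact (congrArg (tmap T _) (M.lv_edge _ _)).trans (tmap_tpure _ _)
  · refine (M.bangTree_rootComp _ _).trans (congrArg (a₂ := M.corollaTree X a) (rootComp _) ?_)
    refine (M.bangTree_node _ _ _).trans (congrArg (node a _) (funext fun i => ?_))
    exact M.edge_congr (M.cls_freeObj k i) _ _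
  · rfl

/-- The label of the lowest node of a tree. -/
def rootLabel {N L : Type} {A : N → Q.Arrow} {z : L → Q.Obj} :
    {y : Q.Obj} → Tree A z y → Option N
  | _, edge _ _ => none
  | _, node n _ _ => some n

theorem freeOp_corolla_injective {q q' : (T.obj (total (M.freeGraph X))).left} {a a' : X.left}
    (h : tmap T (bang _) q = M.dm (M.corolla X a).2)
    (h' : tmap T (bang _) q' = M.dm (M.corolla X a').2)
    (heq : M.freeOp q (M.corolla X a) h = M.freeOp q' (M.corolla X a') h') : a = a' ∧ q = q' := by
  -- An input compatible with the corolla of a lies over the class of `M.rep X a`, so it is a family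
  -- of trees indexed by the source of that arrow.
  obtain ⟨k, rfl⟩ := M.exists_lift (M.rep X a).arr q
    (by rw [h, dm_corolla, cl_rep])
  obtain ⟨k', rfl⟩ := M.exists_lift (M.rep X a').arr q'
    (by rw [h', dm_corolla, cl_rep])
  rw [freeOp_corolla, freeOp_corolla] at heq
  have h1 : a = a' := Option.some.inj (congrArg (fun u : M.FreeEl X => rootLabel u.2) heq)
  subst h1
  refine ⟨rfl, tmap_congr (fun i => ?_) _⟩
  have h2 := eq_of_heq (Sigma.ext_iff.1 heq).2
  obtain ⟨_, h3⟩ := node_injective h2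
  exact M.freeEl_ext _ _ (congrFun h3 i)

theorem freeUnit_ne (s : S) (q : (T.obj (total (M.freeGraph X))).left) (a : X.left)
    (h : tmap T (bang _) q = M.dm (M.corolla X a).2) :
    M.freeUnit s ≠ M.freeOp q (M.corolla X a) h := by
  obtain ⟨k, rfl⟩ := M.exists_lift (M.rep X a).arr q
    (by rw [h, dm_corolla, cl_rep])
  rw [freeOp_corolla]
  intro heq
  have h1 : (none : Option X.left) = some a :=
    congrArg (fun u : M.FreeEl X => rootLabel u.2) heq
  cases h1

end

/-- The labelling of nodes given by a map of graphs. -/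
def labels {R : Operad T} {N : Type} {A : N → Q.Arrow} {X : Over (T1 T).left}
    (r : N → X.left) (hr : ∀ n, X.hom (r n) = M.cl (A n).arr) (φ : X ⟶ R.graph) :
    M.Labelling R A :=
  ⟨fun n => φ.left (r n), fun n => (col_left φ (r n)).trans (hr n)⟩

variable (X : Over (T1 T).left)

/-- The insertion of generators into the free operad. -/
noncomputable def gens : X ⟶ (M.free X).graph :=
  mkHom (X := X) (Y := M.freeGraph X) (M.corolla X) (fun a => M.dm_corolla a)

/-- The labelling of the nodes of a tree with nodes in `X` by a map of graphs. -/
noncomputable abbrev repLabels {R : Operad T} (φ : X ⟶ R.graph) : M.Labelling R (M.rep X) :=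
  M.labels (fun a => a) (fun a => (M.cl_rep X a).symm) φ

/-- A tree is the composite of its own corollas. Hence a morphism out of the free operad is
determined by its values on generators. -/
theorem interp_gens {y : Q.Obj} (t : Tree (M.rep X) M.pt y) :
    (interp (M.repLabels X (M.gens X)) t).1 = M.ofTree X t := by
  induction t with
  | edge l a =>
    refine Eq.trans ?_ (congrArg (M.ofTree X) (M.edge_congr rfl (𝟙 _ ≫ a) a))
    refine Eq.trans ?_ (M.ofTree_rootComp (edge l (𝟙 _)) a).symm
    refine Eq.trans ?_ (M.ofTree_snd (M.freeUnit l)).symm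
    exact congrArg M.freeUnit ((M.cls_eq a).symm.trans (M.cls_pt l))
  | node n a ts ih =>
    refine (M.freeOp_corolla n (interpHom (M.repLabels X (M.gens X)) ts) ?_).trans ?_
    · exact (tmap_bang_tmap _ _).trans ((M.cl_rep X n).trans (M.dm_corolla n).symm)
    · refine Eq.trans ?_ (congrArg (M.ofTree X)
        (congrArg (fun b => node n b ts) (M.thin (𝟙 _ ≫ a) a)))
      refine Eq.trans ?_ (M.ofTree_rootComp (node n (𝟙 _) ts) a).symm
      refine congrArg (fun v => M.ofTree X (node n (𝟙 _) v)) (funext fun i => ?_)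
      have key : ∀ (u : M.FreeEl X) (_ : u = M.ofTree X (ts i)) (b : M.pt u.1 ⟶ _),
          u.2.rootComp b = ts i := by
        rintro _ rfl b
        exact (rootComp_rootComp _ _ _).trans (M.rootComp_self _ _)
      exact key _ (ih i) _

theorem interp_gens_snd (u : M.FreeEl X) : (interp (M.repLabels X (M.gens X)) u.2).1 = u := by
  rw [interp_gens, ofTree_snd]

variable {X}

theorem interp_bangTree {R : Operad T} {N L : Type} {A : N → Q.Arrow} {z : L → Q.Obj}
    (r : M.Labelling R A) {y : Q.Obj} (t : Tree A z y) :
    (interp r (M.bangTree t)).1 = (interp r t).1 :=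
  interp_graft_edge r (fun l => M.cls (z l)) _ t

/-- The extension of a map of graphs to the graph of the free operad. -/
noncomputable abbrev extendMap {R : Operad T} (φ : X ⟶ R.graph) : M.freeGraph X ⟶ R.graph :=
  mkHom (X := M.freeGraph X) (Y := R.graph) (fun t => (interp (M.repLabels X φ) t.2).1)
    (fun _ => hom_interp _ _)

/-- The extension of a map of graphs to a morphism from the free operad. -/
noncomputable def extend {R : Operad T} (φ : X ⟶ R.graph) : M.free X ⟶ R where
  map := M.extendMap φ
  map_ids := over_hom_ext fun s => congrArg R.unit (M.cls_pt s)
  map_comp := over_hom_ext fun ⟨⟨q, t⟩, h⟩ => by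
    obtain ⟨t', rfl, h2⟩ := M.exists_fill q t h
    have e : (interp (M.repLabels X φ) (M.freeOp _ t h).2).1 =
        (interp (M.repLabels X φ) (M.joinTree t')).1 :=
      congrArg (fun u : M.FreeEl X => (interp (M.repLabels X φ) u.2).1)
        (M.freeOp_eq _ t h t' rfl h2)
    -- The composite in the free operad is a graft, and evaluation sends grafts to composites; leaf
    -- labels of the lower tree do not affect its value.
    refine e.trans ((interp_graft (M.repLabels X φ) id (fun l : M.FreeEl X => l.2) t').trans ?_)
    refine Operad.op_congr ?_ ?_ _
    · refine Eq.trans ?_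
        (tmap_tmap (M.freeIso X) (totalMap (M.extendMap φ)) (M.lv t')).symm
      exact tmap_congr (fun _ => rfl) _
    · refine (M.interp_bangTree (M.repLabels X φ) t').symm.trans ?_
      rw [h2]
      rfl

theorem extend_corolla {R : Operad T} (φ : X ⟶ R.graph) (a : X.left) :
    (M.extend φ).map.left (M.corolla X a) = φ.left a := by
  have h : (M.extend φ).map.left (M.corolla X a) =
      (interp (M.repLabels X φ) (M.corollaTree X a)).1 :=
    interp_rootComp (M.repLabels X φ) _ (M.corollaTree X a)
  refine h.trans ?_
  exact Operad.op_unit _ _ (interpHom (M.repLabels X φ)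
    fun i => edge (M.cls ((M.rep X a).src i)) (M.hom (M.cls_pt _))) (fun _ => rfl) _

theorem gens_extend {R : Operad T} (φ : X ⟶ R.graph) : M.gens X ≫ (M.extend φ).map = φ :=
  over_hom_ext fun a => M.extend_corolla φ a

theorem extend_gens {R : Operad T} (g : M.free X ⟶ R) : M.extend (M.gens X ≫ g.map) = g := by
  refine Operad.Hom.ext (over_hom_ext fun t => ?_)
  refine Eq.trans ?_ (congrArg g.map.left (M.interp_gens_snd X t))
  exact (map_interp (M.repLabels X (M.gens X)) g _).symm

theorem forget_isRightAdjoint (M : Model Q T) : (Operad.forget T).IsRightAdjoint :=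
  ⟨_, ⟨Adjunction.adjunctionOfEquivLeft (G := Operad.forget T) (F_obj := fun X => M.free X)
    (fun X _ => ⟨fun g => M.gens X ≫ Operad.Hom.map g, fun φ => M.extend φ,
      fun g => M.extend_gens g, fun φ => M.gens_extend φ⟩)
    (fun _ _ _ _ _ => rfl)⟩⟩

/-- The properties of free operads that determine their elements. -/
structure IsFreeOn (P : Operad T) (φ : X ⟶ P.graph) : Prop where
  op_injective : ∀ {q q'} {a a' : X.left} (h h'),
    P.op q (φ.left a) h = P.op q' (φ.left a') h' → a = a' ∧ q = q'
  unit_ne : ∀ (s q) (a : X.left) (h), P.unit s ≠ P.op q (φ.left a) h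
  exists_tree : ∀ p : P.graph.left, ∃ (y : Q.Obj) (t : Tree (M.rep X) M.pt y),
    (interp (M.repLabels X φ) t).1 = p

/-- Stated for every left adjoint because `freeOperadMonad` is built from an arbitrary choice of
one. It suffices that `F.obj X` is a retract of the operad of trees, compatibly with generators: g
reflects the injectivity statements and g' transports the generation by trees. -/
theorem isFreeOn {F : Over (T1 T).left ⥤ Operad T} (adj : F ⊣ Operad.forget T)
    (X : Over (T1 T).left) : M.IsFreeOn (F.obj X) (adj.unit.app X) := by
  let g : F.obj X ⟶ M.free X := (adj.homEquiv X (M.free X)).symm (M.gens X)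
  let g' : M.free X ⟶ F.obj X := M.extend (adj.unit.app X)
  have hg : adj.unit.app X ≫ g.map = M.gens X := by
    have := (adj.homEquiv X (M.free X)).apply_symm_apply (M.gens X)
    rwa [adj.homEquiv_unit] at this
  have hg' : g ≫ g' = 𝟙 _ := by
    apply (adj.homEquiv X (F.obj X)).injective
    rw [adj.homEquiv_unit, adj.homEquiv_unit]
    have h1 : adj.unit.app X ≫ (g.map ≫ g'.map) = adj.unit.app X := by
      exact (Category.assoc (adj.unit.app X) g.map g'.map).symm.trans
        ((congrArg (· ≫ g'.map) hg).trans (M.gens_extend _))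
    exact h1.trans (Category.comp_id _).symm
  have hl : ∀ p, g'.map.left (g.map.left p) = p := fun p =>
    left_congr (congrArg Operad.Hom.map hg') p
  have hc : ∀ a, g.map.left ((adj.unit.app X).left a) = M.corolla X a := fun a => left_congr hg a
  have hop : ∀ q a h, ∃ h', g.map.left ((F.obj X).op q ((adj.unit.app X).left a) h) =
      M.freeOp (tmap T (totalMap g.map) q) (M.corolla X a) h' := by
    intro q a h
    have h' : tmap T (bang _) (tmap T (totalMap g.map) q) = M.dm (M.corolla X a).2 := by
      rw [tmap_bang_tmap, h, ← hc]
      exact (Operad.map_hom g _).symm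
    refine ⟨h', ?_⟩
    have h'' : tmap T (bang _) (tmap T (totalMap g.map) q) =
        (M.free X).graph.hom (g.map.left ((adj.unit.app X).left a)) := by
      rw [hc]; exact h'
    exact (Operad.map_op g q _ h h'').trans (Operad.op_congr (R := M.free X) rfl (hc a) _)
  refine ⟨?_, ?_, ?_⟩
  · intro q q' a a' h h' heq
    obtain ⟨k, hk⟩ := hop q a h
    obtain ⟨k', hk'⟩ := hop q' a' h'
    obtain ⟨h1, h2⟩ := M.freeOp_corolla_injective k k' (hk.symm.trans
      ((congrArg g.map.left heq).trans hk'))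
    refine ⟨h1, ?_⟩
    have h3 := congrArg (tmap T (totalMap g'.map)) h2
    have h4 : ∀ q, tmap T (totalMap g'.map) (tmap T (totalMap g.map) q) = q := fun q =>
      (tmap_tmap (totalMap g.map) (totalMap g'.map) q).trans 
        (tmap_of_id (f := totalMap g.map ≫ totalMap g'.map) hl q)
    exact (h4 q).symm.trans (h3.trans (h4 q'))
  · intro s q a h heq
    obtain ⟨k, hk⟩ := hop q a h
    exact M.freeUnit_ne s _ a k ((Operad.map_unit g s).symm.trans
      ((congrArg g.map.left heq).trans hk))
  · intro p
    refine ⟨_, (g.map.left p : M.FreeEl X).2, ?_⟩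
    have h1 := congrArg g'.map.left (M.interp_gens_snd X (g.map.left p))
    refine Eq.trans ?_ (h1.trans (hl p))
    refine Eq.trans ?_ (map_interp (M.repLabels X (M.gens X)) g' _).symm
    have h2 : (M.repLabels X (M.gens X)).map g' = M.repLabels X (adj.unit.app X) :=
      congrArg (M.repLabels X) (M.gens_extend (adj.unit.app X))
    exact congrArg (fun r => (interp r _).1) h2.symm

end Model

/-! ### Recovering a tree from its composite in a free operad -/

namespace Model

open SymMulticat SymMulticat.Tree

variable {Q : SymMulticat} {S : Type} {T : Monad (Over S)} (M : Model Q T)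

section IsFreeOn

variable {M} {X : Over (T1 T).left} {P : Operad T} {φ : X ⟶ P.graph}

variable {N N' L L' : Type} {A : N → Q.Arrow} {A' : N' → Q.Arrow} {z : L → Q.Obj} {z' : L' → Q.Obj}

theorem IsFreeOn.interp_node_injective (h : M.IsFreeOn P φ) {r : N → X.left}
    {hr : ∀ n, X.hom (r n) = M.cl (A n).arr} {r' : N' → X.left}
    {hr' : ∀ n, X.hom (r' n) = M.cl (A' n).arr} {n : N} {n' : N'} {y y' : Q.Obj}
    {a : (A n).tgt ⟶ y} {a' : (A' n').tgt ⟶ y'}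
    {ts : ∀ i : Fin (A n).arity, Tree A z ((A n).src i)}
    {ts' : ∀ i : Fin (A' n').arity, Tree A' z' ((A' n').src i)}
    (heq : (interp (M.labels r hr φ) (node n a ts)).1 =
      (interp (M.labels r' hr' φ) (node n' a' ts')).1) :
    r n = r' n' ∧ tmap T (interpHom (M.labels r hr φ) ts) (M.gen (A n).arr) =
      tmap T (interpHom (M.labels r' hr' φ) ts') (M.gen (A' n').arr) :=
  h.op_injective _ _ heq

theorem IsFreeOn.edge_ne_node (h : M.IsFreeOn P φ) {k : M.Labelling P A} {r' : N' → X.left}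
    {hr' : ∀ n, X.hom (r' n) = M.cl (A' n).arr} {l : L} {n' : N'} {y y' : Q.Obj}
    {a : z l ⟶ y} {a' : (A' n').tgt ⟶ y'}
    {ts' : ∀ i : Fin (A' n').arity, Tree A' z' ((A' n').src i)} :
    (interp k (edge l a)).1 ≠ (interp (M.labels r' hr' φ) (node n' a' ts')).1 :=
  h.unit_ne _ _ _ _

/-- Freeness recovers the lowest label and the input; `lift_unique` splits the input into the
composites of the branches. This becomes `lift_unique` for the slice. -/
theorem IsFreeOn.labels_unique (h : M.IsFreeOn P φ) (r r' : N → X.left)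
    (hr : ∀ n, X.hom (r n) = M.cl (A n).arr) (hr' : ∀ n, X.hom (r' n) = M.cl (A n).arr)
    {y : Q.Obj} (t : Tree A z y)
    (heq : (interp (M.labels r hr φ) t).1 = (interp (M.labels r' hr' φ) t).1) (m : t.Nodes) :
    r (t.nodeIdx m) = r' (t.nodeIdx m) := by
  induction t with
  | edge l a => exact m.elim
  | node n a ts ih =>
    obtain ⟨h1, h2⟩ := h.interp_node_injective heq
    obtain _ | ⟨i, m⟩ := m
    · exact h1
    · exact ih i (left_congr (M.lift_unique _ _ _ h2) i) m

/-- Injective labels allow the nodes themselves, and thus the shape, to be read off. This is the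
core of `faithful` for the slice. -/
theorem IsFreeOn.bangTree_eq (h : M.IsFreeOn P φ) (r : N → X.left)
    (hr : ∀ n, X.hom (r n) = M.cl (A n).arr) (hi : Function.Injective r)
    {y : Q.Obj} (t t' : Tree A z y)
    (heq : (interp (M.labels r hr φ) t).1 = (interp (M.labels r hr φ) t').1) :
    M.bangTree t = M.bangTree t' := by
  induction t with
  | edge l a =>
    cases t' with
    | edge l' a' => exact M.edge_congr ((M.cls_eq a).trans (M.cls_eq a').symm) _ _
    | node n' a' ts' => exact (h.edge_ne_node heq).elim
  | node n a ts ih =>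
    cases t' with
    | edge l' a' => exact (h.edge_ne_node heq.symm).elim
    | node n' a' ts' =>
      obtain ⟨h1, h2⟩ := h.interp_node_injective heq
      obtain rfl := hi h1
      have h3 := M.lift_unique _ _ _ h2
      rw [bangTree_node, bangTree_node, M.thin a a']
      exact congrArg (node n a') (funext fun i => ih i _ (left_congr h3 i))

/-- The trees may be built from different arrows of Q, so corresponding nodes share only a class in
T1 and their branches must be matched by `exists_equiv`. The last clause, for every operad R,
transfers equality of composites to other labellings matched by E; it becomes `exists_equiv` for the
slice. -/
theorem IsFreeOn.exists_nodes (h : M.IsFreeOn P φ) (r : N → X.left)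
    (hr : ∀ n, X.hom (r n) = M.cl (A n).arr) (r' : N' → X.left)
    (hr' : ∀ n, X.hom (r' n) = M.cl (A' n).arr) {y : Q.Obj} (t : Tree A z y) {y' : Q.Obj}
    (t' : Tree A' z' y')
    (heq : (interp (M.labels r hr φ) t).1 = (interp (M.labels r' hr' φ) t').1) :
    ∃ E : t.Nodes ≃ t'.Nodes, (∀ m, r (t.nodeIdx m) = r' (t'.nodeIdx (E m))) ∧
      ∀ (R : Operad T) (k : M.Labelling R A) (k' : M.Labelling R A'),
        (∀ m, k.val (t.nodeIdx m) = k'.val (t'.nodeIdx (E m))) →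
        (interp k t).1 = (interp k' t').1 := by
  induction t generalizing y' with
  | @edge l y a =>
    cases t' with
    | edge l' a' =>
      refine ⟨Equiv.refl Empty, fun m => m.elim, fun R k k' _ => ?_⟩
      -- Both composites are units, and equal units have equal colours.
      have h1 := congrArg (col (total P.graph)) heq
      exact congrArg R.unit (((Operad.col_unit _).symm.trans h1).trans (Operad.col_unit _))
    | node n' a' ts' => exact (h.edge_ne_node heq).elim
  | node n a ts ih =>
    cases t' with
    | edge l' a' => exact (h.edge_ne_node heq.symm).elim
    | node n' a' ts' =>
      obtain ⟨h1, h2⟩ := h.interp_node_injective heq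
      have h3 : M.cl (A n).arr = M.cl (A' n').arr := by
        rw [← hr, h1, hr']
      obtain ⟨e, he, H⟩ := M.exists_equiv _ _ h3
      rw [← H, tmap_tmap] at h2
      have h4 := M.lift_unique _ _ _ h2
      choose E hE hE' using fun i => ih i (ts' (e i)) (left_congr h4 i)
      refine ⟨(Equiv.refl Unit).sumCongr (Equiv.sigmaCongr e E), ?_, ?_⟩
      · rintro (_ | ⟨i, m⟩)
        · exact h1
        · exact hE i m
      · intro R k k' hk
        refine Operad.op_congr ?_ (hk (Sum.inl ())) _
        have h5 : ∀ i, (interp k (ts i)).1 = (interp k' (ts' (e i))).1 := fun i =>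
          hE' i R k k' fun m => hk (Sum.inr ⟨i, m⟩)
        rw [← H, tmap_tmap]
        exact tmap_congr h5 _

end IsFreeOn

/-- Labels may repeat or be missing in a tree, while a configuration uses each exactly once;
indexing the nodes by the set of nodes itself repairs this. -/
theorem exists_bijective_nodes {N L : Type} {A : N → Q.Arrow} {z : L → Q.Obj} {y : Q.Obj}
    (t : Tree A z y) : ∃ t' : Tree (fun m => A (t.nodeIdx m)) z y,
      Function.Bijective t'.nodeIdx ∧ relabel t.nodeIdx t' = t := by
  induction t with
  | edge l a => exact ⟨edge l a, ⟨fun m => Empty.elim m, fun m => Empty.elim m⟩, rfl⟩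
  | node n a ts ih =>
    choose t' h1 h2 using ih
    choose E hE using fun i => relabel_nodes (A := fun m => A ((node n a ts).nodeIdx m))
      (fun m : (ts i).Nodes => (Sum.inr ⟨i, m⟩ : (node n a ts).Nodes)) (t' i)
    refine ⟨node (A := fun m => A ((node n a ts).nodeIdx m)) (Sum.inl ()) a (fun i =>
      relabel (A := fun m => A ((node n a ts).nodeIdx m))
      (fun m : (ts i).Nodes => (Sum.inr ⟨i, m⟩ : (node n a ts).Nodes)) (t' i)), ?_, ?_⟩
    · let F : (Unit ⊕ Σ i, (t' i).Nodes) ≃ (Unit ⊕ Σ i, (ts i).Nodes) :=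
        (Equiv.refl Unit).sumCongr
          (Equiv.sigmaCongrRight fun i => Equiv.ofBijective _ (h1 i))
      let G := (Equiv.refl Unit).sumCongr (Equiv.sigmaCongrRight E)
      have : ∀ m, (node (A := fun m => A ((node n a ts).nodeIdx m)) (Sum.inl ()) a (fun i =>
          relabel (A := fun m => A ((node n a ts).nodeIdx m))
          (fun m : (ts i).Nodes => (Sum.inr ⟨i, m⟩ : (node n a ts).Nodes)) (t' i))).nodeIdx (G m) =
          F m := by
        rintro (_ | ⟨i, m⟩)
        · rfl
        · exact (hE i m).symm
      have h3 := F.bijective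
      rw [← funext this] at h3
      exact (Function.Bijective.of_comp_iff _ G.bijective).1 h3
    · refine congrArg (node n a) (funext fun i => ?_)
      exact (relabel_relabel (A := A) (node n a ts).nodeIdx
        (fun m : (ts i).Nodes => (Sum.inr ⟨i, m⟩ : (node n a ts).Nodes)) (t' i)).trans (h2 i)

/-! ### The slice presents the free operad monad -/

section Slice

variable {F : Over (T1 T).left ⥤ Operad T} (adj : F ⊣ Operad.forget T)

/-- The elements of free operads given by configurations. -/
def sliceGen {N : Type} {A : N → Q.Arrow} {B : Q.Arrow} (c : Config A B) :
    (adj.toMonad.obj (fam fun n => M.cl (A n).arr)).left :=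
  (interp (M.labels (X := fam fun n => M.cl (A n).arr) (fun n => n) (fun _ => rfl)
    (adj.unit.app (fam fun n => M.cl (A n).arr))) c.tree).1

/-- Naturality of the adjunction unit: transporting along k only relabels nodes, so questions about
`tmap` become questions about composites of one tree. -/
theorem tmap_sliceGen {N : Type} {A : N → Q.Arrow} {B : Q.Arrow} (c : Config A B)
    {X : Over (T1 T).left} (k : (fam fun n => M.cl (A n).arr) ⟶ X) :
    tmap adj.toMonad k (M.sliceGen adj c) =
      (interp (M.labels k.left (col_left k) (adj.unit.app X)) c.tree).1 := by
  refine (map_interp _ (F.map k) c.tree).trans ?_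
  refine congrArg (fun r => (interp r c.tree).1) (Labelling.ext (funext fun n => ?_))
  exact (left_congr (adj.unit.naturality k) n).symm

/-- The multiplication comes from the counit, a morphism of operads, hence commutes with evaluation;
a triangle identity then restores k as the labelling. -/
theorem tbind_sliceGen {N : Type} {A : N → Q.Arrow} {B : Q.Arrow} (c : Config A B)
    {X : Over (T1 T).left} (k : (fam fun n => M.cl (A n).arr) ⟶ adj.toMonad.obj X) :
    tbind adj.toMonad k (M.sliceGen adj c) =
      (interp (M.labels (X := fam fun n => M.cl (A n).arr) (R := F.obj X) (fun n => n)
        (fun _ => rfl) k) c.tree).1 := by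
  refine (congrArg (adj.toMonad.μ.app X).left (M.tmap_sliceGen adj c k)).trans ?_
  refine (map_interp _ (adj.counit.app (F.obj X)) c.tree).trans ?_
  refine congrArg (fun r => (interp r c.tree).1) ?_
  have h : (adj.unit.app (adj.toMonad.obj X)) ≫
      (Operad.forget T).map (adj.counit.app (F.obj X)) = 𝟙 _ :=
    adj.right_triangle_components (F.obj X)
  refine congrArg (fun f => M.labels (R := F.obj X) k.left (col_left k) f) h

theorem sliceGen_perm {N N' : Type} (e : N ≃ N') {A : N → Q.Arrow} {A' : N' → Q.Arrow}
    {B : Q.Arrow} (c : Config A B) (h : ∀ n, A n = A' (e n)) :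
    M.sliceGen adj (Config.perm e c h) = tmap adj.toMonad
      (mkHom (X := fam fun n => M.cl (A n).arr) (Y := fam fun n => M.cl (A' n).arr) e
        (fun n => congrArg (fun A : Q.Arrow => M.cl A.arr) (h n).symm)) (M.sliceGen adj c) := by
  obtain rfl : A = fun n => A' (e n) := funext h
  rw [tmap_sliceGen]
  exact interp_relabel _ e c.tree

theorem sliceGen_ofHom {A B : Q.Arrow} (α : A ⟶ B) :
    M.sliceGen adj (Config.ofHom α) =
      tpure adj.toMonad (fam fun _ : Unit => M.cl A.arr) () :=
  interp_ofHom α _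

theorem sliceGen_comp {I : Type} {K : I → Type} {x : I → Q.Arrow} {B : Q.Arrow}
    {w : ∀ i, K i → Q.Arrow} (f : Config x B) (g : ∀ i, Config (w i) (x i))
    (h : ∀ i, col _ (tmap adj.toMonad (mkHom (X := fam fun j => M.cl (w i j).arr)
      (Y := fam fun p : Σ i, K i => M.cl (w p.1 p.2).arr) (fun j => (⟨i, j⟩ : Σ i, K i))
        (fun _ => rfl)) (M.sliceGen adj (g i))) = M.cl (x i).arr) :
    M.sliceGen adj (Config.comp f g) = tbind adj.toMonad
      (mkHom (X := fam fun i => M.cl (x i).arr)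
        (Y := adj.toMonad.obj (fam fun p : Σ i, K i => M.cl (w p.1 p.2).arr))
        (fun i => tmap adj.toMonad (mkHom (X := fam fun j => M.cl (w i j).arr)
          (fun j => (⟨i, j⟩ : Σ i, K i)) (fun _ => rfl)) (M.sliceGen adj (g i))) h)
        (M.sliceGen adj f) := by
  rw [tbind_sliceGen]
  refine (interp_subst _ g f.tree).trans ?_
  refine congrArg (fun r => (interp r f.tree).1) (Labelling.ext (funext fun i => ?_))
  exact (M.tmap_sliceGen adj (g i) (mkHom (X := fam fun j => M.cl (w i j).arr)
    (Y := fam fun p : Σ i, K i => M.cl (w p.1 p.2).arr) (fun j => (⟨i, j⟩ : Σ i, K i))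
      (fun _ => rfl))).symm

/-- The leaf condition of a configuration is automatic: the leaf labelling and the bijection from
`exists_equiv` both carry `gen t.eval` to `gen B.arr`, so they coincide. Then `faithful` gives the
evaluation law. -/
theorem config_of_tree {N : Type} {A : N → Q.Arrow} {B : Q.Arrow} (t : Tree A B.src B.tgt)
    (hn : Function.Bijective t.nodeIdx) (hl : M.lv t = M.gen B.arr) :
    ∃ c : Config A B, c.tree = t := by
  obtain ⟨e, he, H⟩ := M.exists_equiv t.eval B.arr (by
    rw [← hl]; exact (tmap_bang_tmap _ _).symm)
  have h := M.lift_unique _ _ _ (hl.trans H.symm)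
  have h' : t.leafIdx = e := funext fun l => left_congr h l
  refine ⟨⟨t, hn, h' ▸ e.bijective, M.faithful _ _ ?_⟩, rfl⟩
  exact (M.gen_perm (x' := B.src) _ t.eval (fun _ => rfl)).trans hl

theorem col_sliceGen {N : Type} {A : N → Q.Arrow} {B : Q.Arrow} (c : Config A B) :
    col _ (M.sliceGen adj c) = M.cl B.arr :=
  (hom_interp _ c.tree).trans (M.cl_eq_dm c).symm

/-- The free operad monad is described by the slice. -/
noncomputable def slice : Model Q.slice adj.toMonad where
  cls A := M.cl (SymMulticat.Arrow.arr A)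
  thin a b := M.arrowHom_subsingleton a b
  cls_eq a := M.cl_eq_of_arrowHom a
  exists_hom h := M.exists_arrowHom h
  cls_surj := M.exists_arrow
  gen c := M.sliceGen adj c
  col_gen c := M.col_sliceGen adj c
  gen_perm e _ _ _ c h := M.sliceGen_perm adj e c h
  gen_incl α := M.sliceGen_ofHom adj α
  gen_comp f g := M.sliceGen_comp adj f g _
  lift_unique {N A B} c X k k' h := by
    have h1 := (M.tmap_sliceGen adj c k).symm.trans (h.trans (M.tmap_sliceGen adj c k'))
    refine over_hom_ext fun n => ?_
    -- Every index labels a node of a configuration, so agreement on nodes is enough.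
    obtain ⟨m, rfl⟩ := c.nodes.surjective n
    exact (M.isFreeOn adj X).labels_unique _ _ _ _ _ h1 m
  exists_equiv {N N' A A' B B'} c c' h := by
    have h1 := (M.tmap_sliceGen adj c _).symm.trans (h.trans (M.tmap_sliceGen adj c' _))
    obtain ⟨E, h2, h3⟩ := (M.isFreeOn adj _).exists_nodes _ _ _ _ _ _ h1
    let e : N ≃ N' := (Equiv.ofBijective _ c.nodes).symm.trans
      (E.trans (Equiv.ofBijective _ c'.nodes))
    have he : ∀ m, e (c.tree.nodeIdx m) = c'.tree.nodeIdx (E m) := fun m =>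
      congrArg (fun m => c'.tree.nodeIdx (E m))
        ((Equiv.ofBijective _ c.nodes).symm_apply_apply m)
    refine ⟨e, fun n => ?_, ?_⟩
    · obtain ⟨m, rfl⟩ := c.nodes.surjective n
      rw [he]
      exact (h2 m).symm
    · refine (M.tmap_sliceGen adj c _).trans ?_
      refine h3 _ _ _ fun m => ?_
      exact congrArg (adj.unit.app (fam fun n => M.cl (A' n).arr)).left (he m)
  faithful {N A B} c c' h := by
    refine Config.ext (M.tree_ext _ _ ?_ ((M.lv_tree c).trans (M.lv_tree c').symm))
    exact (M.isFreeOn adj (fam fun n => M.cl (A n).arr)).bangTree_eq (fun n => n) _ (fun _ _ h => h) _ _ h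
  exists_gen {X} q := by
    obtain ⟨y, t, rfl⟩ := (M.isFreeOn adj X).exists_tree q
    -- The target B is any arrow of the class of t; relabelling the leaves of t by the source of B
    -- makes the leaf data equal to `gen B.arr`.
    obtain ⟨B, hB⟩ := M.exists_arrow (M.dm t)
    have hy : M.cls y = M.cls B.tgt := by
      rw [← M.col_dm t, ← hB, M.col_cl]
    obtain ⟨t₁, h1, h2⟩ := M.exists_leaves (Y := M.src B.src) B.src (fun _ => rfl)
      (t.rootComp (M.hom hy)) (M.gen B.arr) (hB.trans (M.dm_rootComp _ t).symm)
    have h1' : M.lv t₁ = M.gen B.arr := (tmap_of_id (fun _ => rfl) _).symm.trans h1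
    obtain ⟨t₂, h3, h4⟩ := exists_bijective_nodes t₁
    obtain ⟨c, hc⟩ := M.config_of_tree t₂ h3 (by rw [← h1', ← M.lv_relabel, h4])
    refine ⟨_, _, B, c, mkHom (X := fam fun m => M.cl (M.rep X (t₁.nodeIdx m)).arr) t₁.nodeIdx
      (fun m => (M.cl_rep X _).symm), ?_⟩
    refine (M.tmap_sliceGen adj c _).trans ?_
    rw [hc]
    let r := M.repLabels X (R := F.obj X) (adj.unit.app X)
    refine (interp_relabel r t₁.nodeIdx t₂).symm.trans ?_
    rw [h4, ← M.interp_bangTree r t₁, h2, M.interp_bangTree r]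
    exact interp_rootComp r _ t

end Slice

/-! ### The base case, the induction and the equivalence -/

/-- The identity monad on sets is described by the terminal symmetric multicategory with one
unary arrow. -/
noncomputable def unit : Model SymMulticat.unit (Monad.id (Over Unit)) where
  cls _ := ()
  thin a b := (fun {x y : Discrete Unit} (a b : x ⟶ y) => Subsingleton.elim a b) a b
  cls_eq _ := rfl
  exists_hom _ := ⟨eqToHom (Subsingleton.elim (α := Discrete Unit) _ _)⟩
  cls_surj _ := ⟨⟨()⟩, rfl⟩
  gen f := f.down.some.default
  col_gen _ := rfl
  gen_perm e _ _ _ f h := (SymMulticat.unit.perm e f h).down.some.eq_default _ |>.symm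
  gen_incl _ := rfl
  gen_comp f g := (SymMulticat.unit.comp f g).down.some.eq_default _ |>.symm
  lift_unique f X h h' heq := over_hom_ext fun i => by
    obtain rfl : i = f.down.some.default := f.down.some.eq_default i
    exact heq
  exists_equiv f f' _ := by
    have := f.down.some
    have := f'.down.some
    exact ⟨Equiv.ofUnique _ _, fun _ => rfl, f'.down.some.eq_default _⟩
  faithful f f' _ := PLift.down_injective rfl
  exists_gen {X} q := ⟨Unit, fun _ => ⟨()⟩, ⟨()⟩, ⟨⟨inferInstance⟩⟩,
    mkHom (X := fam fun _ : Unit => ()) (fun _ => q) (fun _ => rfl), rfl⟩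

/-- A model provides the left adjoint, so the default branch of `freeOperadMonad` is never taken. -/
theorem nonempty_freeOperadMonad (M : Model Q T) : Nonempty (Model Q.slice (freeOperadMonad T)) := by
  have h : freeOperadMonad T = _ := dif_pos M.forget_isRightAdjoint
  rw [h]
  exact ⟨M.slice _⟩

theorem nonempty_iteratedSlice (k : ℕ) :
    Nonempty (Model (iteratedSlice SymMulticat.unit k) (leinsterMonad k).T) := by
  induction k with
  | zero => exact ⟨Model.unit⟩
  | succ k ih =>
    obtain ⟨M⟩ := ih
    exact M.nonempty_freeOperadMonad

/-- The category of objects is equivalent to the discrete category of classes. -/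
theorem nonempty_equivalence (M : Model Q T) : Nonempty (Q.Obj ≌ Discrete S) := by
  let G : Q.Obj ⥤ Discrete S :=
    { obj := fun x => ⟨M.cls x⟩
      map := fun a => Discrete.eqToHom (M.cls_eq a) }
  have : G.Faithful := ⟨fun _ => M.thin _ _⟩
  have : G.Full := ⟨fun a => ⟨M.hom (Discrete.eq_of_hom a), Subsingleton.elim _ _⟩⟩
  have : G.EssSurj := ⟨fun s => ⟨M.pt s.as, ⟨Discrete.eqToIso (M.cls_pt s.as)⟩⟩⟩
  have : G.IsEquivalence := {}
  exact ⟨G.asEquivalence⟩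

end Model

theorem mainTheorem1 (k : ℕ) :
    (SetMonad.Operad.forget (leinsterMonad k).T).IsRightAdjoint ∧
      Nonempty (BaezDolanOpetope k ≌ Discrete (LeinsterOpetope k)) := by
  obtain ⟨M⟩ := Model.nonempty_iteratedSlice k
  exact ⟨M.forget_isRightAdjoint, M.nonempty_equivalence⟩
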